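/- **Setting.** Let $\mathcal E\subseteq\mathbb R^d$ be a closed cone, let $g_1,\dots,g_K:\mathbb R^m\times\mathbb R^d\to[-\infty,\infty]$ be lower semicontinuous, let $\mathcal X\subseteq\mathbb R^m$ and $c:\mathcal X\to\mathbb R$. Put $g=\max_k g_k$, $\mathcal S(x)=\{z\in\mathcal E: g(x,z)\le 0\}$ and $\mathcal X'=\{x\in\mathcal X:\operatorname{int}\mathcal S(x)\ne\emptyset\}$. A set-valued map $T$ is *non-vacuous* if $\mathcal E\setminus T(x)\neq\emptyset$ for every $x\in\mathcal X$ and $\mathcal E\setminus T(x)$ is bounded away from $0$ for every $x\in\mathcal X'$. Let $r\neq0$ and assume that one of the following holds. * (A1) For all $x\in\mathcal X$, $t>1$: $t^rx\in\mathcal X$ and $\mathcal S(t^rx)=t\,\mathcal S(x)$; moreover $\mathcal S$ is (Painlevé–Kuratowski) continuous on $\mathcal X$ and non-vacuous. * (A2) For all $x\in\mathcal X$, $t>1$: $t^rx\in\mathcal X$; and there are $\rho\ge0$ and $g^*:\mathbb R^m\times\mathbb R^d\to[-\infty,\infty]$ such that $\liminf_n n^{-\rho}g(n^rx_n,nz_n)\ge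 g^*(x,z)$ whenever $(x_n,z_n)\to(x,z)$; for every $x_n\to x$ and every $z$ there is $z_n\to z$ with $\limsup_n n^{-\rho}g(n^rx_n,nz_n)\le g^*(x,z)$; and $x\mapsto\{z\in\mathcal E:g^*(x,z)\le0\}$ is non-vacuous. Assume that $c$ is positively homogeneous ($c(tx)=t\,c(x)$ whenever $t>0$ and $x,tx\in\mathcal X$) and that $t\mapsto c(t^rx)$ is strictly increasing (on the $t>0$ with $t^rx\in\mathcal X$) for every $x\in\mathcal X'$. Assume also the following regularity: $\mathcal X\cup\{0\}$ is closed; there is $M>0$ such that $sx\in\mathcal X$ whenever $x\in\mathcal X\setminus\{0\}$, $s>0$ and $\|sx\|^{1/r}\ge M$ (which is automatic if $\mathcal X$ is a cone); $c$ is continuous on $\mathcal X$, and $r\,c(x)>0$ for every nonzero $x\in\mathcal X$; and $\mathcal E\setminus\mathcal S(x)\ne\emptyset$ for every $x\in\mathcal X$. **Ambiguity set.** Fix $\mu\in\mathbb R^d$, and let $\mathcal P$ be the set of all Borel probability measures $\mathbb Q$ on $\mathbb R^d$ with $E_{\mathbb Q}[\xi]=\mu$ and $E_{\mathbb Q}[d(\xi)]\preceq\sigma$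 (all moments finite), for one of the following choices: $d_{cov}(z)=(z-\mu)(z-\mu)^\top$, with $\preceq$ the positive semidefinite order and $\sigma$ positive definite, where $p:=2$; or, for some $p\in[1,\infty)$, $d_{ad,p}(z)=(|z_i-\mu_i|^p)_{i\le d}$, or $d_{sd,p}(z)=((z_i-\mu_i)_+^p,(\mu_i-z_i)_+^p)_{i\le d}$, or $d_{norm,p}(z)=\|z-\mu\|^p$ for a norm on $\mathbb R^d$, with $\preceq$ the componentwise order and all components of $\sigma$ positive. Let $x^{\tt md}_\alpha$ denote any optimal solution of $$\min_{x\in\mathcal X} c(x)\quad\text{s.t.}\quad\inf_{\mathbb Q\in\mathcal P}\mathbb Q\{g_k(x,\xi)\le0,\ k=1,\dots,K\}\ge1-\alpha .$$ **Theorem.** For every $\varepsilon>0$ there are constants $v>0$ and $\alpha_0>0$, not depending on $\alpha$, such that for every $\alpha\in(0,\alpha_0)$ and every such optimal solution $$c(x^{\tt md}_\alpha)\ \ge\ \operatorname{sgn}(r)\;v\;\alpha^{-r/(p+\varepsilon)} .$$ In particular $c(x^{\tt md}_\alpha)\ge v\,\alpha^{-r/(p+\varepsilon)}$ when $r>0$.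 The same holds if $\mathcal P$ is instead defined by the equality $E_{\mathbb Q}[d(\xi)]=\sigma$, provided that this set is nonempty. -/

import Mathlib

open Filter Topology MeasureTheory
open scoped Pointwise ENNReal

noncomputable section

namespace MomentDRO

/-! ### Constraint functions, safe sets -/

/-- The safe set `S(x)` of scenarios in the closed cone `E` at which all constraints hold. -/
def safeSet {m d K : ℕ} (g : Fin K → (Fin m → ℝ) → (Fin d → ℝ) → EReal) (E : Set (Fin d → ℝ))
    (x : Fin m → ℝ) : Set (Fin d → ℝ) :=
  {z | z ∈ E ∧ (⨆ k, g k x z) ≤ 0}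

/-- The decisions `X'` whose safe set has nonempty interior. -/
def decisionsWithInterior {m d K : ℕ} (g : Fin K → (Fin m → ℝ) → (Fin d → ℝ) → EReal)
    (E : Set (Fin d → ℝ)) (X : Set (Fin m → ℝ)) : Set (Fin m → ℝ) :=
  {x | x ∈ X ∧ (interior (safeSet g E x)).Nonempty}

/-- Non-vacuous set-valued map `T`, for the support `E` and the decision set `X`; the set `X'` of
decisions at which the unsafe set has to stay away from the origin is an argument. -/
def NonVacuous {m d : ℕ} (E : Set (Fin d → ℝ)) (X X' : Set (Fin m → ℝ))
    (T : (Fin m → ℝ) → Set (Fin d → ℝ)) : Prop :=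
  (∀ x ∈ X, (E \ T x).Nonempty) ∧
    ∀ x ∈ X', ∃ δ : ℝ, 0 < δ ∧ ∀ z ∈ E \ T x, δ ≤ ‖z‖

/-- Outer limit of a sequence of sets. -/
def outerLimit {d : ℕ} (A : ℕ → Set (Fin d → ℝ)) : Set (Fin d → ℝ) :=
  {z | ∀ ε : ℝ, 0 < ε → ∃ᶠ n in atTop, ∃ y ∈ A n, dist z y ≤ ε}

/-- Inner limit of a sequence of sets. -/
def innerLimit {d : ℕ} (A : ℕ → Set (Fin d → ℝ)) : Set (Fin d → ℝ) :=
  {z | ∀ ε : ℝ, 0 < ε → ∀ᶠ n in atTop, ∃ y ∈ A n, dist z y ≤ ε}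

/-- Continuity of a set-valued map relative to `X` (Painlevé–Kuratowski). -/
def SetValuedContinuousOn {m d : ℕ} (T : (Fin m → ℝ) → Set (Fin d → ℝ))
    (X : Set (Fin m → ℝ)) : Prop :=
  ∀ x ∈ X, ∀ u : ℕ → Fin m → ℝ, (∀ n, u n ∈ X) → Tendsto u atTop (𝓝 x) →
    outerLimit (fun n => T (u n)) = T x ∧ innerLimit (fun n => T (u n)) = T x

/-- Homogeneous safe-set model with scaling exponent `r`. -/
def HomogeneousSafeSets {m d K : ℕ} (g : Fin K → (Fin m → ℝ) → (Fin d → ℝ) → EReal)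
    (E : Set (Fin d → ℝ)) (X : Set (Fin m → ℝ)) (r : ℝ) : Prop :=
  (∀ x ∈ X, ∀ t : ℝ, 1 < t →
    t ^ r • x ∈ X ∧ safeSet g E (t ^ r • x) = t • safeSet g E x) ∧
  SetValuedContinuousOn (safeSet g E) X ∧
  NonVacuous E X (decisionsWithInterior g E X) (safeSet g E)

/-- Non-homogeneous safe-set model with scaling exponent `r`: the rescaled constraint functions
converge (epigraphically in `z`, continuously in `x`) to a function `gs` whose sublevel sets are
non-vacuous. -/
def AsymptoticSafeSets {m d K : ℕ} (g : Fin K → (Fin m → ℝ) → (Fin d → ℝ) → EReal)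
    (E : Set (Fin d → ℝ)) (X : Set (Fin m → ℝ)) (r : ℝ) : Prop :=
  (∀ x ∈ X, ∀ t : ℝ, 1 < t → t ^ r • x ∈ X) ∧
  ∃ (ρ : ℝ) (gs : (Fin m → ℝ) → (Fin d → ℝ) → EReal), 0 ≤ ρ ∧
    (∀ (x : Fin m → ℝ) (z : Fin d → ℝ) (u : ℕ → Fin m → ℝ) (w : ℕ → Fin d → ℝ),
      Tendsto u atTop (𝓝 x) → Tendsto w atTop (𝓝 z) →
      gs x z ≤ liminf (fun n : ℕ =>
        (⨆ k, g k ((n : ℝ) ^ r • u n) ((n : ℝ) • w n)) / (((n : ℝ) ^ ρ : ℝ) : EReal)) atTop) ∧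
    (∀ (x : Fin m → ℝ) (z : Fin d → ℝ) (u : ℕ → Fin m → ℝ), Tendsto u atTop (𝓝 x) →
      ∃ w : ℕ → Fin d → ℝ, Tendsto w atTop (𝓝 z) ∧
      limsup (fun n : ℕ =>
        (⨆ k, g k ((n : ℝ) ^ r • u n) ((n : ℝ) • w n)) / (((n : ℝ) ^ ρ : ℝ) : EReal)) atTop
        ≤ gs x z) ∧
    NonVacuous E X (decisionsWithInterior g E X) (fun x => {z | z ∈ E ∧ gs x z ≤ 0})

/-- Positively homogeneous cost on `X`, with `t ↦ c (t ^ r • x)` strictly increasing for `x` in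
`X'`. Only values of `c` on `X` matter. -/
def HomogeneousCost {m : ℕ} (c : (Fin m → ℝ) → ℝ) (X X' : Set (Fin m → ℝ)) (r : ℝ) : Prop :=
  (∀ x ∈ X, ∀ t : ℝ, 0 < t → t • x ∈ X → c (t • x) = t * c x) ∧
  ∀ x ∈ X', StrictMonoOn (fun t : ℝ => c (t ^ r • x)) {t | 0 < t ∧ t ^ r • x ∈ X}

/-! ### Mean-dispersion ambiguity sets -/

/-- Probability measures on `ℝ^d` with mean `μ` and `E[disp] ⪯_D σ`. -/
def meanDispersionLe {d : ℕ} {W : Type*} [NormedAddCommGroup W] [NormedSpace ℝ W]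
    (μ : Fin d → ℝ) (disp : (Fin d → ℝ) → W) (D : Set W) (σ : W) :
    Set (Measure (Fin d → ℝ)) :=
  {Q | IsProbabilityMeasure Q ∧ Integrable (fun z => z) Q ∧ ∫ z, z ∂Q = μ ∧
    Integrable disp Q ∧ σ - ∫ z, disp z ∂Q ∈ D}

/-- Probability measures on `ℝ^d` with mean `μ` and `E[disp] = σ`. -/
def meanDispersionEq {d : ℕ} {W : Type*} [NormedAddCommGroup W] [NormedSpace ℝ W]
    (μ : Fin d → ℝ) (disp : (Fin d → ℝ) → W) (σ : W) : Set (Measure (Fin d → ℝ)) :=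
  {Q | IsProbabilityMeasure Q ∧ Integrable (fun z => z) Q ∧ ∫ z, z ∂Q = μ ∧
    Integrable disp Q ∧ ∫ z, disp z ∂Q = σ}

/-- `(z - μ)(z - μ)ᵀ`. -/
def dispCov {d : ℕ} (μ z : Fin d → ℝ) : Fin d → Fin d → ℝ :=
  fun i j => (z i - μ i) * (z j - μ j)

/-- Componentwise `|z - μ| ^ p`. -/
def dispAbs {d : ℕ} (p : ℝ) (μ z : Fin d → ℝ) : Fin d → ℝ :=
  fun i => |z i - μ i| ^ p

/-- Componentwise upper and lower parts `((z - μ)₊ ^ p, (μ - z)₊ ^ p)`. -/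
def dispSemi {d : ℕ} (p : ℝ) (μ z : Fin d → ℝ) : Fin d → ℝ × ℝ :=
  fun i => (max (z i - μ i) 0 ^ p, max (μ i - z i) 0 ^ p)

/-- `N (z - μ) ^ p`. -/
def dispNorm {d : ℕ} (N : Seminorm ℝ (Fin d → ℝ)) (p : ℝ) (μ z : Fin d → ℝ) : ℝ :=
  N (z - μ) ^ p

/-- The four dispersion models, with their bound `σ`. -/
inductive Dispersion (d : ℕ) : Type
  | cov (σ : Matrix (Fin d) (Fin d) ℝ) : Dispersion d
  | absDev (p : ℝ) (σ : Fin d → ℝ) : Dispersion d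
  | semiDev (p : ℝ) (σ : Fin d → ℝ × ℝ) : Dispersion d
  | normMoment (N : Seminorm ℝ (Fin d → ℝ)) (p : ℝ) (σ : ℝ) : Dispersion d

namespace Dispersion

/-- The moment order `p`, which is `2` for the covariance. -/
def order {d : ℕ} : Dispersion d → ℝ
  | cov _ => 2
  | absDev p _ => p
  | semiDev p _ => p
  | normMoment _ p _ => p

/-- `1 ≤ p < ∞`, the function `N` in the norm moment is a norm, and the bound is non-degenerate
(it lies in the interior of the cone that orders the dispersions). -/
def Admissible {d : ℕ} : Dispersion d → Prop
  | cov σ => σ.PosDef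
  | absDev p σ => 1 ≤ p ∧ ∀ i, 0 < σ i
  | semiDev p σ => 1 ≤ p ∧ ∀ i, 0 < (σ i).1 ∧ 0 < (σ i).2
  | normMoment N p σ => 1 ≤ p ∧ (∀ z, N z = 0 → z = 0) ∧ 0 < σ

/-- The ambiguity set with dispersion bounded by `σ`, in the positive semidefinite order for the
covariance and in the componentwise order otherwise. -/
def ambiguityLe {d : ℕ} (μ : Fin d → ℝ) : Dispersion d → Set (Measure (Fin d → ℝ))
  | cov σ => meanDispersionLe μ (dispCov μ) {A | (Matrix.of A).PosSemidef} (fun i j => σ i j)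
  | absDev p σ => meanDispersionLe μ (dispAbs p μ) {w | 0 ≤ w} σ
  | semiDev p σ => meanDispersionLe μ (dispSemi p μ) {w | 0 ≤ w} σ
  | normMoment N p σ => meanDispersionLe μ (dispNorm N p μ) {w | 0 ≤ w} σ

/-- The ambiguity set with dispersion equal to `σ`. -/
def ambiguityEq {d : ℕ} (μ : Fin d → ℝ) : Dispersion d → Set (Measure (Fin d → ℝ))
  | cov σ => meanDispersionEq μ (dispCov μ) (fun i j => σ i j)
  | absDev p σ => meanDispersionEq μ (dispAbs p μ) σ
  | semiDev p σ => meanDispersionEq μ (dispSemi p μ) σ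
  | normMoment N p σ => meanDispersionEq μ (dispNorm N p μ) σ

end Dispersion

/-! ### The distributionally robust chance-constrained problem -/

/-- Feasible decisions at target level `1 - α` for the ambiguity set `P`. -/
def droFeasible {m d K : ℕ} (g : Fin K → (Fin m → ℝ) → (Fin d → ℝ) → EReal)
    (X : Set (Fin m → ℝ)) (P : Set (Measure (Fin d → ℝ))) (α : ℝ) : Set (Fin m → ℝ) :=
  {x | x ∈ X ∧ ENNReal.ofReal (1 - α) ≤ ⨅ Q ∈ P, Q {z | ∀ k, g k x z ≤ 0}}

/-- Optimal decisions of the distributionally robust chance-constrained problem. -/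
def IsDROOptimal {m d K : ℕ} (c : (Fin m → ℝ) → ℝ)
    (g : Fin K → (Fin m → ℝ) → (Fin d → ℝ) → EReal)
    (X : Set (Fin m → ℝ)) (P : Set (Measure (Fin d → ℝ))) (α : ℝ) (x : Fin m → ℝ) : Prop :=
  x ∈ droFeasible g X P α ∧ ∀ y ∈ droFeasible g X P α, c x ≤ c y

end MomentDRO

end

/-!
The gauge of a nonzero decision `x` is `‖x‖ ^ (1 / r)`; it is the factor `t` in `x = t ^ r • y` with
`y` of unit norm. The bound on the optimal cost compares three quantities: the level `α`, the
distance of the origin to the unsafe set `E \ S(x)`, and the gauge of `x`.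

*From `α` to unsafe scenarios.* For every `y` and every small `q` with `q * ‖y‖ ^ p ≤ κ`, the
ambiguity set has a measure with an atom of mass at least `q` at `μ + y`
(`exists_atom_ambiguity`). It puts mass `q` on each of `μ + y` and `μ - y`, which keeps the mean,
and the rest on a measure that makes up for the missing dispersion. That dispersion is still
admissible because `σ` lies in the interior of the ordering cone, and it is realized by finitely
many atoms. If `x` is feasible at level `α`, no unsafe scenario may be such an atom with `q > α`,
so all unsafe scenarios have norm at least of order `α ^ (-1 / p)`
(`exists_unsafe_norm_lower_bound`).

*From unsafe scenarios to the gauge.* Conversely, a decision whose gauge is bounded away from `0`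
has an unsafe scenario of norm at most a multiple of its gauge (`exists_unsafe_le_gauge`). Large
gauges are scaled back by an integer power `n ^ r` to a compact annulus. There, each `y` has a
scenario `z` such that `n • z` is unsafe for all `n ^ r • u` with `u` near `y` and `n` large, by
homogeneity of the safe sets or by the lower limit inequality (`exists_eventually_unsafe`). The
remaining gauges belong to a compact set, where lower semicontinuity of the constraints gives a
bound.

*Small gauges.* The set of feasible decisions shrinks with `α`, so the optimal cost at one small
level bounds the optimal costs at all smaller levels from below. Since homogeneity and the sign
condition make `r * c x` comparable to `‖x‖` (`exists_norm_bounds_cost`), the gauges of those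
optimal decisions are bounded away from `0`, and their cost is bounded in terms of the gauge. The
zero decision, which has no gauge, is infeasible at small levels because some scenario is unsafe
for it.

Together, the gauge of an optimal decision is at least of order `α ^ (-1 / p)`, which gives the
bound with exponent `-(r / p)`, and this is stronger than the one with `-(r / (p + ε))`.
-/

namespace MomentDRO

/-! ### Measures with prescribed mean and dispersion -/

section Atoms

-- `W` lives in `Type`, as the scenario space does, so that the local integration formulas apply to
-- the identity and to `disp` alike.
variable {d : ℕ} {W : Type} [NormedAddCommGroup W] [NormedSpace ℝ W] [CompleteSpace W]

/-- A finite family of displacements from `μ` that balances out gives a probability measure with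
mean `μ`, the remaining mass sitting at `μ`, where the dispersion vanishes. -/
theorem meanDispersionEq_nonempty_of_atoms {ι : Type*} [Fintype ι] {μ : Fin d → ℝ}
    {disp : (Fin d → ℝ) → W} (hμ : disp μ = 0) {w : ι → ℝ} (hw : ∀ i, 0 ≤ w i)
    (hsum : ∑ i, w i ≤ 1) {y : ι → Fin d → ℝ} (hy : ∑ i, w i • y i = 0) {τ : W}
    (hτ : ∑ i, w i • disp (μ + y i) = τ) :
    (meanDispersionEq μ disp τ).Nonempty := by
  have hint : ∀ {V : Type _} [NormedAddCommGroup V] (f : (Fin d → ℝ) → V) (t : ℝ) (a : Fin d → ℝ),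
      Integrable f (ENNReal.ofReal t • Measure.dirac a) := fun f t a =>
    (integrable_dirac (by simp)).smul_measure ENNReal.ofReal_ne_top
  have hint' : ∀ {V : Type _} [NormedAddCommGroup V] (f : (Fin d → ℝ) → V),
      Integrable f (∑ i, ENNReal.ofReal (w i) • Measure.dirac (μ + y i)) := fun f =>
    integrable_finsetSum_measure.2 fun i _ => hint f _ _
  have hval : ∀ {V : Type _} [NormedAddCommGroup V] [NormedSpace ℝ V] [CompleteSpace V]
      (f : (Fin d → ℝ) → V),
      ∫ z, f z ∂(ENNReal.ofReal (1 - ∑ i, w i) • Measure.dirac μ +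
        ∑ i, ENNReal.ofReal (w i) • Measure.dirac (μ + y i)) =
      (1 - ∑ i, w i) • f μ + ∑ i, w i • f (μ + y i) := fun f => by
    rw [integral_add_measure (hint f _ _) (hint' f),
      integral_finsetSum_measure fun i _ => hint f _ _]
    simp only [integral_smul_measure, integral_dirac]
    rw [ENNReal.toReal_ofReal (by linarith)]
    simp only [ENNReal.toReal_ofReal (hw _)]
  refine ⟨_, ⟨?_⟩, (hint _ _ _).add_measure (hint' _), (hval _).trans ?_,
    (hint _ _ _).add_measure (hint' _), (hval _).trans ?_⟩
  · have h1 : ∑ i, ENNReal.ofReal (w i) = ENNReal.ofReal (∑ i, w i) :=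
      (ENNReal.ofReal_sum_of_nonneg fun i _ => hw i).symm
    simp only [Measure.coe_add, Measure.coe_smul, Measure.coe_finsetSum, Pi.add_apply,
      Pi.smul_apply, Finset.sum_apply, measure_univ, smul_eq_mul, mul_one, h1]
    rw [← ENNReal.ofReal_add (by linarith) (Finset.sum_nonneg fun i _ => hw i)]
    simp
  · simp only [smul_add, Finset.sum_add_distrib, hy, ← Finset.sum_smul]
    rw [add_zero, ← add_smul]
    simp
  · rw [hμ, hτ]; simp

/-- Mixing with a pair of atoms that is symmetric about the mean keeps the mean. -/
theorem exists_atom_of_mem_meanDispersionEq {μ : Fin d → ℝ} {disp : (Fin d → ℝ) → W}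
    {τ : W} (hne : (meanDispersionEq μ disp τ).Nonempty) {q : ℝ} (hq : 0 ≤ q) (hq2 : 2 * q ≤ 1)
    (y : Fin d → ℝ) :
    ∃ Q ∈ meanDispersionEq μ disp
      ((1 - 2 * q) • τ + q • (disp (μ + y) + disp (μ + -y))),
      ENNReal.ofReal q ≤ Q {μ + y} := by
  obtain ⟨Q, hQ, hid, hmean, hdisp, hQτ⟩ := hne
  have hint : ∀ {V : Type _} [NormedAddCommGroup V] (f : (Fin d → ℝ) → V) (a : Fin d → ℝ),
      Integrable f (ENNReal.ofReal q • Measure.dirac a) := fun f a =>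
    (integrable_dirac (by simp)).smul_measure ENNReal.ofReal_ne_top
  have hint2 : ∀ {V : Type _} [NormedAddCommGroup V] (f : (Fin d → ℝ) → V),
      Integrable f (ENNReal.ofReal q • Measure.dirac (μ + y) +
        ENNReal.ofReal q • Measure.dirac (μ + -y)) := fun f => (hint f _).add_measure (hint f _)
  have hint3 : ∀ {V : Type _} [NormedAddCommGroup V] (f : (Fin d → ℝ) → V), Integrable f Q →
      Integrable f (ENNReal.ofReal (1 - 2 * q) • Q) := fun f hf =>
    hf.smul_measure ENNReal.ofReal_ne_top
  have hval : ∀ {V : Type _} [NormedAddCommGroup V] [NormedSpace ℝ V] [CompleteSpace V]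
      (f : (Fin d → ℝ) → V), Integrable f Q →
      ∫ z, f z ∂(ENNReal.ofReal (1 - 2 * q) • Q + (ENNReal.ofReal q • Measure.dirac (μ + y) +
        ENNReal.ofReal q • Measure.dirac (μ + -y))) =
      (1 - 2 * q) • ∫ z, f z ∂Q + q • (f (μ + y) + f (μ + -y)) := fun f hf => by
    rw [integral_add_measure (hint3 f hf) (hint2 f),
      integral_add_measure (hint f _) (hint f _)]
    simp only [integral_smul_measure, integral_dirac]
    rw [ENNReal.toReal_ofReal (by linarith), ENNReal.toReal_ofReal hq, smul_add]
  refine ⟨_, ⟨⟨?_⟩, (hint3 _ hid).add_measure (hint2 _), (hval _ hid).trans ?_,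
    (hint3 _ hdisp).add_measure (hint2 _), (hval _ hdisp).trans ?_⟩, ?_⟩
  · simp only [Measure.coe_add, Measure.coe_smul, Pi.add_apply, Pi.smul_apply, measure_univ,
      smul_eq_mul, mul_one]
    rw [← ENNReal.ofReal_add hq hq, ← ENNReal.ofReal_add (by linarith) (by linarith)]
    rw [show 1 - 2 * q + (q + q) = 1 by ring, ENNReal.ofReal_one]
  · rw [hmean]
    ext i
    simp only [Pi.add_apply, Pi.smul_apply, Pi.neg_apply, smul_eq_mul]
    ring
  · rw [hQτ]
  · calc ENNReal.ofReal q = (ENNReal.ofReal q • Measure.dirac (μ + y)) {μ + y} := by simp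
      _ ≤ _ := by
        simp only [Measure.coe_add, Pi.add_apply]
        exact le_self_add.trans le_add_self

/-- Every dispersion that a probability measure can have after an atom of mass `q` at `μ + y`
and its mirror image have been removed leads to a measure with such an atom. -/
theorem exists_atom_of_nonempty {μ : Fin d → ℝ} {disp : (Fin d → ℝ) → W}
    {σ : W} {q : ℝ} (hq : 0 ≤ q) (hq2 : q ≤ 1 / 4) (y : Fin d → ℝ)
    (hne : (meanDispersionEq μ disp
      ((1 - 2 * q)⁻¹ • (σ - q • (disp (μ + y) + disp (μ + -y))))).Nonempty) :
    ∃ Q ∈ meanDispersionEq μ disp σ, ENNReal.ofReal q ≤ Q {μ + y} := by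
  obtain ⟨Q, hQ, h⟩ := exists_atom_of_mem_meanDispersionEq hne hq (by linarith) y
  rw [smul_inv_smul₀ (by linarith), sub_add_cancel] at hQ
  exact ⟨Q, hQ, h⟩

/-- The variant for an ambiguity set with bounded dispersion, where the rest of the mass can sit
at `μ`. -/
theorem exists_atom_of_sub_mem {μ : Fin d → ℝ} {disp : (Fin d → ℝ) → W} {D : Set W}
    (hμ : disp μ = 0) {σ : W} {q : ℝ} (hq : 0 ≤ q) (hq2 : q ≤ 1 / 4) (y : Fin d → ℝ)
    (hD : σ - q • (disp (μ + y) + disp (μ + -y)) ∈ D) :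
    ∃ Q ∈ meanDispersionLe μ disp D σ, ENNReal.ofReal q ≤ Q {μ + y} := by
  have hne : (meanDispersionEq μ disp 0).Nonempty :=
    meanDispersionEq_nonempty_of_atoms (ι := Fin 0) (w := fun _ => 0) (y := fun _ => 0) hμ
      (by simp) (by simp) (by simp) (by simp)
  obtain ⟨Q, ⟨h1, h2, h3, h4, h5⟩, h⟩ :=
    exists_atom_of_mem_meanDispersionEq hne hq (by linarith) y
  exact ⟨Q, ⟨h1, h2, h3, h4, by simpa [h5] using hD⟩, h⟩

end Atoms

section Models

variable {d : ℕ}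

/-! ### Dispersion at the mean -/

theorem dispCov_self (μ : Fin d → ℝ) : dispCov μ μ = 0 := by
  ext i j; simp [dispCov]

theorem dispAbs_self {p : ℝ} (hp : 1 ≤ p) (μ : Fin d → ℝ) : dispAbs p μ μ = 0 := by
  ext i; simp [dispAbs, Real.zero_rpow (by linarith : p ≠ 0)]

theorem dispSemi_self {p : ℝ} (hp : 1 ≤ p) (μ : Fin d → ℝ) : dispSemi p μ μ = 0 := by
  ext i <;> simp [dispSemi, Real.zero_rpow (by linarith : p ≠ 0)]

theorem dispNorm_self (N : Seminorm ℝ (Fin d → ℝ)) {p : ℝ} (hp : 1 ≤ p) (μ : Fin d → ℝ) :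
    dispNorm N p μ μ = 0 := by
  simp [dispNorm, Real.zero_rpow (by linarith : p ≠ 0)]

/-! ### Prescribed dispersion: covariance -/

/-- A positive definite quadratic form dominates a multiple of the squared norm. -/
theorem exists_le_dotProduct_mulVec {σ : Matrix (Fin d) (Fin d) ℝ} (hσ : σ.PosDef) :
    ∃ l : ℝ, 0 < l ∧ ∀ x : Fin d → ℝ, l * ‖x‖ ^ 2 ≤ x ⬝ᵥ σ.mulVec x := by
  have hcont : Continuous fun x : Fin d → ℝ => x ⬝ᵥ σ.mulVec x := by
    simp only [dotProduct, Matrix.mulVec]; fun_prop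
  have hpos : ∀ x : Fin d → ℝ, x ≠ 0 → 0 < x ⬝ᵥ σ.mulVec x := fun x hx => by
    simpa using hσ.dotProduct_mulVec_pos hx
  have hscale : ∀ x : Fin d → ℝ, x ≠ 0 → ‖x‖⁻¹ • x ∈ Metric.sphere (0 : Fin d → ℝ) 1 := by
    intro x hx
    rw [mem_sphere_zero_iff_norm, norm_smul, norm_inv, norm_norm,
      inv_mul_cancel₀ (norm_ne_zero_iff.2 hx)]
  rcases (Metric.sphere (0 : Fin d → ℝ) 1).eq_empty_or_nonempty with hE | hne
  · refine ⟨1, one_pos, fun x => ?_⟩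
    by_cases hx : x = 0
    · simp [hx]
    · simpa [hE] using hscale x hx
  · obtain ⟨y, hy, hmin⟩ := (isCompact_sphere (0 : Fin d → ℝ) 1).exists_isMinOn hne
      hcont.continuousOn
    refine ⟨_, hpos y (by rintro rfl; simp at hy), fun x => ?_⟩
    by_cases hx : x = 0
    · simp [hx]
    · have h1 : y ⬝ᵥ σ.mulVec y ≤ (‖x‖⁻¹ • x) ⬝ᵥ σ.mulVec (‖x‖⁻¹ • x) := hmin (hscale x hx)
      have hn : 0 < ‖x‖ := norm_pos_iff.2 hx
      rw [Matrix.mulVec_smul, smul_dotProduct, dotProduct_smul, smul_eq_mul, smul_eq_mul] at h1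
      calc y ⬝ᵥ σ.mulVec y * ‖x‖ ^ 2
          ≤ ‖x‖⁻¹ * (‖x‖⁻¹ * x ⬝ᵥ σ.mulVec x) * ‖x‖ ^ 2 := by gcongr
        _ = x ⬝ᵥ σ.mulVec x := by field_simp

/-- The rows of a matrix square root of `τ` serve as displacements, each with both signs. -/
theorem meanDispersionEq_dispCov_nonempty (μ : Fin d → ℝ) {τ : Matrix (Fin d) (Fin d) ℝ}
    (hτ : τ.PosSemidef) : (meanDispersionEq μ (dispCov μ) (fun i j => τ i j)).Nonempty := by
  obtain ⟨B, hB⟩ : ∃ B : Matrix (Fin d) (Fin d) ℝ, τ = star B * B := by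
    open scoped MatrixOrder in
    exact CStarAlgebra.nonneg_iff_eq_star_mul_self.1 hτ.nonneg
  rcases Nat.eq_zero_or_pos d with hd | hd
  · subst hd
    exact meanDispersionEq_nonempty_of_atoms (ι := Fin 0) (w := fun _ => 0) (y := fun _ => 0)
      (dispCov_self μ) (by simp) (by simp) (by simp) (Subsingleton.elim _ _)
  have hd' : (0 : ℝ) < d := by exact_mod_cast hd
  refine meanDispersionEq_nonempty_of_atoms (ι := Fin d ⊕ Fin d) (w := fun _ => 1 / (2 * d))
    (y := Sum.elim (fun k => √d • B k) (fun k => -(√d • B k)))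
    (dispCov_self μ) (fun _ => by positivity) ?_ ?_ ?_
  · simp only [Finset.sum_const, Finset.card_univ, Fintype.card_sum, Fintype.card_fin,
      nsmul_eq_mul]
    apply le_of_eq; push_cast; field_simp; ring
  · simp only [Fintype.sum_sum_type, Sum.elim_inl, Sum.elim_inr, smul_neg, Finset.sum_neg_distrib]
    simp
  · ext i j
    have hs : √(d : ℝ) * √(d : ℝ) = d := Real.mul_self_sqrt hd'.le
    simp only [Fintype.sum_sum_type, Sum.elim_inl, Sum.elim_inr, Pi.add_apply, Finset.sum_apply,
      Pi.smul_apply, dispCov, Pi.neg_apply, smul_eq_mul, hB, Matrix.mul_apply, Matrix.star_apply,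
      star_trivial, ← Finset.sum_add_distrib]
    refine Finset.sum_congr rfl fun k _ => ?_
    calc _ = (√(d : ℝ) * √(d : ℝ)) * (B k i * B k j) / d := by ring
      _ = _ := by rw [hs]; field_simp

/-- A small multiple of a rank-one matrix can be split off a positive definite matrix. -/
theorem exists_posSemidef_sub {σ : Matrix (Fin d) (Fin d) ℝ} (hσ : σ.PosDef) (μ : Fin d → ℝ) :
    ∃ κ : ℝ, 0 < κ ∧ ∀ (y : Fin d → ℝ) (q : ℝ), 0 ≤ q → q * ‖y‖ ^ (2 : ℝ) ≤ κ →
      (Matrix.of ((fun i j => σ i j) -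
        q • (dispCov μ (μ + y) + dispCov μ (μ + -y)))).PosSemidef := by
  obtain ⟨l, hl, hσl⟩ := exists_le_dotProduct_mulVec hσ
  refine ⟨l / (2 * (d ^ 2 + 1)), by positivity, fun y q hq h => ?_⟩
  rw [Real.rpow_two] at h
  have e : Matrix.of ((fun i j => σ i j) - q • (dispCov μ (μ + y) + dispCov μ (μ + -y))) =
      σ - (2 * q) • Matrix.vecMulVec y y := by
    ext i j
    simp only [dispCov, Matrix.of_apply, Pi.sub_apply, Pi.smul_apply, Pi.add_apply, Pi.neg_apply,
      smul_eq_mul, Matrix.sub_apply, Matrix.smul_apply, Matrix.vecMulVec_apply]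
    ring
  rw [e]
  refine Matrix.PosSemidef.of_dotProduct_mulVec_nonneg (hσ.1.sub ?_) fun x => ?_
  · ext i j
    simp [Matrix.vecMulVec_apply, mul_comm]
  · have h1 : |y ⬝ᵥ x| ≤ d * (‖y‖ * ‖x‖) := by
      calc |y ⬝ᵥ x| ≤ ∑ i, |y i * x i| := Finset.abs_sum_le_sum_abs _ _
        _ ≤ ∑ _i : Fin d, ‖y‖ * ‖x‖ := by
          refine Finset.sum_le_sum fun i _ => ?_
          rw [abs_mul]
          exact mul_le_mul (norm_le_pi_norm y i) (norm_le_pi_norm x i) (abs_nonneg _)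
            (norm_nonneg _)
        _ = _ := by simp
    have h2 : (y ⬝ᵥ x) ^ 2 ≤ d ^ 2 * ‖y‖ ^ 2 * ‖x‖ ^ 2 := by
      calc (y ⬝ᵥ x) ^ 2 = |y ⬝ᵥ x| ^ 2 := (sq_abs _).symm
        _ ≤ (d * (‖y‖ * ‖x‖)) ^ 2 := by gcongr
        _ = _ := by ring
    rw [le_div_iff₀ (by positivity)] at h
    have h3 := hσl x
    have h4 : star x ⬝ᵥ (σ - (2 * q) • Matrix.vecMulVec y y).mulVec x =
        x ⬝ᵥ σ.mulVec x - 2 * q * (y ⬝ᵥ x) ^ 2 := by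
      rw [star_trivial, Matrix.sub_mulVec, dotProduct_sub, Matrix.smul_mulVec,
        Matrix.vecMulVec_mulVec, dotProduct_smul]
      simp only [op_smul_eq_smul, dotProduct_smul, smul_eq_mul, dotProduct_comm x y]
      ring
    rw [h4]
    have h5 : 2 * q * (y ⬝ᵥ x) ^ 2 ≤ 2 * q * (d ^ 2 * ‖y‖ ^ 2 * ‖x‖ ^ 2) := by gcongr
    have h6 : 0 ≤ (l - q * ‖y‖ ^ 2 * (2 * (d ^ 2 + 1))) * ‖x‖ ^ 2 :=
      mul_nonneg (by linarith) (by positivity)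
    have h7 : 0 ≤ q * ‖y‖ ^ 2 * ‖x‖ ^ 2 := by positivity
    nlinarith

theorem exists_atom_cov {σ : Matrix (Fin d) (Fin d) ℝ} (hσ : σ.PosDef) (μ : Fin d → ℝ) :
    ∃ κ : ℝ, 0 < κ ∧ ∀ (y : Fin d → ℝ) (q : ℝ), 0 ≤ q → q ≤ 1 / 4 → q * ‖y‖ ^ (2 : ℝ) ≤ κ →
      (∃ Q ∈ (Dispersion.cov σ).ambiguityLe μ, ENNReal.ofReal q ≤ Q {μ + y}) ∧
      (∃ Q ∈ (Dispersion.cov σ).ambiguityEq μ, ENNReal.ofReal q ≤ Q {μ + y}) := by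
  obtain ⟨κ, hκ, h⟩ := exists_posSemidef_sub hσ μ
  refine ⟨κ, hκ, fun y q hq hq4 hqy => ⟨?_, ?_⟩⟩
  · exact exists_atom_of_sub_mem (dispCov_self μ) hq hq4 y (h y q hq hqy)
  · refine exists_atom_of_nonempty hq hq4 y ?_
    have h1 := (h y q hq hqy).smul (inv_nonneg.2 (by linarith : (0 : ℝ) ≤ 1 - 2 * q))
    exact meanDispersionEq_dispCov_nonempty μ h1

/-! ### Prescribed dispersion: componentwise moments -/

theorem exists_pos_forall_le {ι : Type*} [Finite ι] {f : ι → ℝ} (hf : ∀ i, 0 < f i) :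
    ∃ κ : ℝ, 0 < κ ∧ ∀ i, κ ≤ f i := by
  rcases isEmpty_or_nonempty ι with h | h
  · exact ⟨1, one_pos, fun i => h.elim i⟩
  · obtain ⟨i, hi⟩ := Finite.exists_min f
    exact ⟨f i, hf i, hi⟩

theorem dispAbs_add (p : ℝ) (μ y : Fin d → ℝ) (i : Fin d) :
    dispAbs p μ (μ + y) i = |y i| ^ p := by simp [dispAbs]

theorem dispSemi_add (p : ℝ) (μ y : Fin d → ℝ) (i : Fin d) :
    dispSemi p μ (μ + y) i = (max (y i) 0 ^ p, max (-y i) 0 ^ p) := by simp [dispSemi]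

theorem max_rpow_add_max_neg_rpow {p : ℝ} (hp : 1 ≤ p) (t : ℝ) :
    max t 0 ^ p + max (-t) 0 ^ p = |t| ^ p := by
  have h0 : (0 : ℝ) ^ p = 0 := Real.zero_rpow (by linarith)
  rcases le_total 0 t with h | h
  · rw [max_eq_left h, max_eq_right (neg_nonpos.2 h), abs_of_nonneg h, h0, add_zero]
  · rw [max_eq_right h, max_eq_left (neg_nonneg.2 h), abs_of_nonpos h, h0, zero_add]

theorem mul_abs_rpow_le {p q κ : ℝ} (hp : 1 ≤ p) (hq : 0 ≤ q) {y : Fin d → ℝ}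
    (h : q * ‖y‖ ^ p ≤ κ) (i : Fin d) : q * |y i| ^ p ≤ κ := by
  refine le_trans ?_ h
  have := norm_le_pi_norm y i
  rw [Real.norm_eq_abs] at this
  gcongr

/-- Displacements along the coordinate axes, each with both signs, realize the componentwise
absolute moments `τ`. -/
theorem meanDispersionEq_dispAbs_nonempty {p : ℝ} (hp : 1 ≤ p) (μ : Fin d → ℝ) {τ : Fin d → ℝ}
    (hτ : ∀ i, 0 ≤ τ i) : (meanDispersionEq μ (dispAbs p μ) τ).Nonempty := by
  have hp0 : p ≠ 0 := by linarith
  rcases Nat.eq_zero_or_pos d with hd | hd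
  · subst hd
    exact meanDispersionEq_nonempty_of_atoms (ι := Fin 0) (w := fun _ => 0) (y := fun _ => 0)
      (dispAbs_self hp μ) (by simp) (by simp) (by simp) (Subsingleton.elim _ _)
  have hd' : (0 : ℝ) < d := by exact_mod_cast hd
  refine meanDispersionEq_nonempty_of_atoms (ι := Fin d ⊕ Fin d) (w := fun _ => 1 / (2 * d))
    (y := Sum.elim (fun k => Pi.single k ((d * τ k) ^ (1 / p)))
      (fun k => -Pi.single k ((d * τ k) ^ (1 / p))))
    (dispAbs_self hp μ) (fun _ => by positivity) ?_ ?_ ?_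
  · simp only [Finset.sum_const, Finset.card_univ, Fintype.card_sum, Fintype.card_fin,
      nsmul_eq_mul]
    apply le_of_eq; push_cast; field_simp; ring
  · simp only [Fintype.sum_sum_type, Sum.elim_inl, Sum.elim_inr, smul_neg, Finset.sum_neg_distrib]
    simp
  · ext i
    have ha : 0 ≤ d * τ i := mul_nonneg hd'.le (hτ i)
    simp only [Fintype.sum_sum_type, Sum.elim_inl, Sum.elim_inr, Finset.sum_apply,
      Pi.smul_apply, dispAbs_add, Pi.neg_apply, smul_eq_mul, abs_neg]
    rw [Finset.sum_eq_single i (fun k _ hk => by simp [Pi.single_eq_of_ne' hk, hp0])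
      (fun h => absurd (Finset.mem_univ i) h), Pi.single_eq_same,
      abs_of_nonneg (by positivity), ← Real.rpow_mul ha, one_div_mul_cancel hp0, Real.rpow_one]
    field_simp; ring

theorem exists_atom_absDev {p : ℝ} (hp : 1 ≤ p) {σ : Fin d → ℝ} (hσ : ∀ i, 0 < σ i)
    (μ : Fin d → ℝ) :
    ∃ κ : ℝ, 0 < κ ∧ ∀ (y : Fin d → ℝ) (q : ℝ), 0 ≤ q → q ≤ 1 / 4 → q * ‖y‖ ^ p ≤ κ →
      (∃ Q ∈ (Dispersion.absDev p σ).ambiguityLe μ, ENNReal.ofReal q ≤ Q {μ + y}) ∧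
      (∃ Q ∈ (Dispersion.absDev p σ).ambiguityEq μ, ENNReal.ofReal q ≤ Q {μ + y}) := by
  obtain ⟨κ, hκ, h⟩ := exists_pos_forall_le hσ
  refine ⟨κ / 2, by positivity, fun y q hq hq4 hqy => ?_⟩
  have h1 : ∀ i, 0 ≤ (σ - q • (dispAbs p μ (μ + y) + dispAbs p μ (μ + -y))) i := fun i => by
    have := mul_abs_rpow_le hp hq hqy i
    simp only [Pi.sub_apply, Pi.smul_apply, Pi.add_apply, dispAbs_add, Pi.neg_apply, abs_neg,
      smul_eq_mul]
    linarith [h i]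
  refine ⟨exists_atom_of_sub_mem (dispAbs_self hp μ) hq hq4 y h1,
    exists_atom_of_nonempty hq hq4 y (meanDispersionEq_dispAbs_nonempty hp μ fun i => ?_)⟩
  exact mul_nonneg (inv_nonneg.2 (by linarith)) (h1 i)

/-! ### Prescribed dispersion: semideviations -/

/-- Displacements `a i`, `-b i` along the axes with probabilities `u i`, `v i` balance out if
`u i * a i = v i * b i`, and contribute to one semideviation each. -/
theorem meanDispersionEq_dispSemi_nonempty_of_weights {p : ℝ} (hp : 1 ≤ p) (μ : Fin d → ℝ)
    {u v a b : Fin d → ℝ} (hu : ∀ i, 0 ≤ u i) (hv : ∀ i, 0 ≤ v i) (ha : ∀ i, 0 ≤ a i)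
    (hb : ∀ i, 0 ≤ b i) (hsum : ∑ i, (u i + v i) ≤ 1) (hbal : ∀ i, u i * a i = v i * b i) :
    (meanDispersionEq μ (dispSemi p μ)
      (fun i => (u i * a i ^ p, v i * b i ^ p))).Nonempty := by
  have h0 : (0 : ℝ) ^ p = 0 := Real.zero_rpow (by linarith)
  refine meanDispersionEq_nonempty_of_atoms (ι := Fin d ⊕ Fin d) (w := Sum.elim u v)
    (y := Sum.elim (fun k => Pi.single k (a k)) (fun k => -Pi.single k (b k)))
    (dispSemi_self hp μ) ?_ ?_ ?_ ?_
  · rintro (i | i)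
    exacts [hu i, hv i]
  · simpa [Finset.sum_add_distrib] using hsum
  · ext i
    simp only [Fintype.sum_sum_type, Sum.elim_inl, Sum.elim_inr, Finset.sum_apply,
      Pi.smul_apply, Pi.neg_apply, smul_eq_mul, Pi.zero_apply]
    rw [Finset.sum_eq_single i (fun k _ hk => by simp [Pi.single_eq_of_ne' hk])
      (fun h => absurd (Finset.mem_univ i) h),
      Finset.sum_eq_single i (fun k _ hk => by simp [Pi.single_eq_of_ne' hk])
      (fun h => absurd (Finset.mem_univ i) h), Pi.single_eq_same, Pi.single_eq_same, hbal]
    ring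
  · ext1 i
    simp only [Fintype.sum_sum_type, Sum.elim_inl, Sum.elim_inr, Finset.sum_apply,
      Pi.smul_apply, dispSemi_add, Pi.neg_apply]
    rw [Finset.sum_eq_single i (fun k _ hk => by simp [Pi.single_eq_of_ne' hk, h0])
      (fun h => absurd (Finset.mem_univ i) h),
      Finset.sum_eq_single i (fun k _ hk => by simp [Pi.single_eq_of_ne' hk, h0])
      (fun h => absurd (Finset.mem_univ i) h), Pi.single_eq_same, Pi.single_eq_same]
    simp [ha i, hb i, h0]

/-- For `p = 1` the mean forces both semideviations of a coordinate to agree. -/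
theorem fst_eq_snd_of_dispSemi_one {μ : Fin d → ℝ} {σ : Fin d → ℝ × ℝ}
    (h : (meanDispersionEq μ (dispSemi 1 μ) σ).Nonempty) (i : Fin d) : (σ i).1 = (σ i).2 := by
  obtain ⟨Q, hQ, hid, hmean, hdisp, hQσ⟩ := h
  have hi := hdisp.eval i
  have e : σ i = ∫ z, dispSemi 1 μ z i ∂Q := by rw [← hQσ, eval_integral fun j => hdisp.eval j]
  rw [e, fst_integral hi, snd_integral hi, ← sub_eq_zero, ← integral_sub hi.fst hi.snd]
  calc ∫ z, ((dispSemi 1 μ z i).1 - (dispSemi 1 μ z i).2) ∂Q = ∫ z, (z i - μ i) ∂Q := by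
        congr 1; ext z
        simp only [dispSemi, Real.rpow_one]
        rw [← neg_sub (z i) (μ i)]
        exact max_zero_sub_max_neg_zero_eq_self _
    _ = 0 := by
        rw [integral_sub (hid.eval i) (integrable_const _), ← eval_integral fun j => hid.eval j,
          hmean]
        simp

theorem meanDispersionEq_dispSemi_nonempty {p : ℝ} (hp : 1 ≤ p) (μ : Fin d → ℝ)
    {τ : Fin d → ℝ × ℝ} (hτ : ∀ i, 0 < (τ i).1 ∧ 0 < (τ i).2)
    (hτ1 : p = 1 → ∀ i, (τ i).1 = (τ i).2) :
    (meanDispersionEq μ (dispSemi p μ) τ).Nonempty := by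
  rcases hp.eq_or_lt with hp1 | hp1
  · subst hp1
    have hd' : ∀ _ : Fin d, (0 : ℝ) < d := fun i => by exact_mod_cast i.pos
    have h := meanDispersionEq_dispSemi_nonempty_of_weights (p := 1) hp μ
      (u := fun _ => 1 / (2 * d)) (v := fun _ => 1 / (2 * d))
      (a := fun i => 2 * d * (τ i).1) (b := fun i => 2 * d * (τ i).2)
      (fun i => by positivity) (fun i => by positivity)
      (fun i => mul_nonneg (by positivity) (hτ i).1.le)
      (fun i => mul_nonneg (by positivity) (hτ i).2.le) ?_ (fun i => by rw [hτ1 rfl i])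
    · convert h using 2
      funext i
      have := hd' i
      apply Prod.ext <;> simp only [Real.rpow_one] <;> field_simp
    · rcases Nat.eq_zero_or_pos d with hd | hd
      · subst hd; simp
      · have hd' : (0 : ℝ) < d := by exact_mod_cast hd
        simp only [Finset.sum_const, Finset.card_univ, Fintype.card_fin, nsmul_eq_mul]
        apply le_of_eq; field_simp; ring
  · -- With `β = 1 / (p - 1)`, weights `s ^ (-β)` and displacements `s ^ β` have product `1` and
    -- moment `s`; the constant `C` brings the total weight below `1`.
    set β : ℝ := 1 / (p - 1) with hβ
    have hp0 : p ≠ 0 := by linarith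
    have hβp : β * p - β = 1 := by
      rw [hβ]; field_simp [sub_ne_zero.2 hp1.ne']
    set C : ℝ := 1 + ∑ i, ((τ i).1 ^ (-β) + (τ i).2 ^ (-β)) with hC
    have hS : 0 ≤ ∑ i, ((τ i).1 ^ (-β) + (τ i).2 ^ (-β)) := Finset.sum_nonneg fun i _ =>
      add_nonneg (Real.rpow_nonneg (hτ i).1.le _) (Real.rpow_nonneg (hτ i).2.le _)
    have hC0 : 0 < C := by linarith
    have hprod : ∀ s : ℝ, 0 < s → s ^ (-β) / C * (C ^ (1 / p) * s ^ β) = C ^ (1 / p) / C := by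
      intro s hs
      have : s ^ (-β) * s ^ β = 1 := by rw [← Real.rpow_add hs]; simp
      calc _ = (s ^ (-β) * s ^ β) * (C ^ (1 / p) / C) := by ring
        _ = _ := by rw [this, one_mul]
    have hmom : ∀ s : ℝ, 0 < s → s ^ (-β) / C * (C ^ (1 / p) * s ^ β) ^ p = s := by
      intro s hs
      rw [Real.mul_rpow (by positivity) (by positivity), ← Real.rpow_mul hC0.le,
        one_div_mul_cancel hp0, Real.rpow_one, ← Real.rpow_mul hs.le]
      have : s ^ (-β) * s ^ (β * p) = s := by
        rw [← Real.rpow_add hs, show -β + β * p = 1 by linarith, Real.rpow_one]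
      calc _ = s ^ (-β) * s ^ (β * p) := by field_simp
        _ = s := this
    have hpos : ∀ s : ℝ, 0 < s → 0 ≤ s ^ (-β) / C ∧ 0 ≤ C ^ (1 / p) * s ^ β := fun s hs =>
      ⟨by positivity, by positivity⟩
    have h := meanDispersionEq_dispSemi_nonempty_of_weights hp μ
      (u := fun i => (τ i).1 ^ (-β) / C) (v := fun i => (τ i).2 ^ (-β) / C)
      (a := fun i => C ^ (1 / p) * (τ i).1 ^ β) (b := fun i => C ^ (1 / p) * (τ i).2 ^ β)
      (fun i => (hpos _ (hτ i).1).1) (fun i => (hpos _ (hτ i).2).1)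
      (fun i => (hpos _ (hτ i).1).2) (fun i => (hpos _ (hτ i).2).2) ?_
      (fun i => (hprod _ (hτ i).1).trans (hprod _ (hτ i).2).symm)
    · convert h using 2
      funext i
      exact Prod.ext (hmom _ (hτ i).1).symm (hmom _ (hτ i).2).symm
    · simp only [← add_div]
      rw [← Finset.sum_div, div_le_one hC0]
      linarith

theorem exists_atom_semiDev {p : ℝ} (hp : 1 ≤ p) {σ : Fin d → ℝ × ℝ}
    (hσ : ∀ i, 0 < (σ i).1 ∧ 0 < (σ i).2) (μ : Fin d → ℝ) :
    ∃ κ : ℝ, 0 < κ ∧ ∀ (y : Fin d → ℝ) (q : ℝ), 0 ≤ q → q ≤ 1 / 4 → q * ‖y‖ ^ p ≤ κ →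
      (∃ Q ∈ (Dispersion.semiDev p σ).ambiguityLe μ, ENNReal.ofReal q ≤ Q {μ + y}) ∧
      (((Dispersion.semiDev p σ).ambiguityEq μ).Nonempty →
        ∃ Q ∈ (Dispersion.semiDev p σ).ambiguityEq μ, ENNReal.ofReal q ≤ Q {μ + y}) := by
  obtain ⟨κ, hκ, h⟩ := exists_pos_forall_le (f := fun i => min (σ i).1 (σ i).2)
    fun i => lt_min (hσ i).1 (hσ i).2
  refine ⟨κ / 2, by positivity, fun y q hq hq4 hqy => ?_⟩
  have e : ∀ i, (σ - q • (dispSemi p μ (μ + y) + dispSemi p μ (μ + -y))) i =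
      ((σ i).1 - q * |y i| ^ p, (σ i).2 - q * |y i| ^ p) := fun i => by
    simp only [Pi.sub_apply, Pi.smul_apply, Pi.add_apply, dispSemi_add, Pi.neg_apply, neg_neg,
      Prod.mk_add_mk, Prod.smul_mk, smul_eq_mul, max_rpow_add_max_neg_rpow hp]
    rw [add_comm (max (-y i) 0 ^ p), max_rpow_add_max_neg_rpow hp]
    rfl
  have h1 : ∀ i, 0 < (σ i).1 - q * |y i| ^ p ∧ 0 < (σ i).2 - q * |y i| ^ p := fun i => by
    have h2 := mul_abs_rpow_le hp hq hqy i
    have h3 := (h i).trans (min_le_left _ _)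
    have h4 := (h i).trans (min_le_right _ _)
    exact ⟨by linarith, by linarith⟩
  have hq' : 0 < (1 - 2 * q)⁻¹ := inv_pos.2 (by linarith)
  refine ⟨exists_atom_of_sub_mem (dispSemi_self hp μ) hq hq4 y fun i => ?_, fun hne =>
    exists_atom_of_nonempty hq hq4 y (meanDispersionEq_dispSemi_nonempty hp μ (fun i => ?_) ?_)⟩
  · rw [e]
    exact ⟨(h1 i).1.le, (h1 i).2.le⟩
  · rw [Pi.smul_apply, e]
    exact ⟨mul_pos hq' (h1 i).1, mul_pos hq' (h1 i).2⟩
  · rintro rfl i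
    rw [Pi.smul_apply, e]
    simp only [Prod.smul_mk, fst_eq_snd_of_dispSemi_one hne i]

/-! ### Prescribed dispersion: norm moments -/

theorem exists_seminorm_le_mul_norm (N : Seminorm ℝ (Fin d → ℝ)) :
    ∃ C : ℝ, 0 < C ∧ ∀ y, N y ≤ C * ‖y‖ := by
  refine ⟨1 + ∑ i, N (Pi.single i 1), by positivity, fun y => ?_⟩
  calc N y = N (∑ i, y i • Pi.single i (1 : ℝ)) := by
        congr 1; ext j; simp [Finset.sum_apply, Pi.single_apply]
    _ ≤ ∑ i, N (y i • Pi.single i (1 : ℝ)) :=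
        Finset.le_sum_of_subadditive N (map_zero N).le (map_add_le_add N) _ _
    _ ≤ ∑ i, ‖y‖ * N (Pi.single i 1) := by
        refine Finset.sum_le_sum fun i _ => ?_
        rw [map_smul_eq_mul]
        exact mul_le_mul_of_nonneg_right (norm_le_pi_norm y i) (apply_nonneg N _)
    _ ≤ _ := by
        rw [← Finset.mul_sum]
        nlinarith [norm_nonneg y]

theorem dispNorm_add (N : Seminorm ℝ (Fin d → ℝ)) (p : ℝ) (μ y : Fin d → ℝ) :
    dispNorm N p μ (μ + y) = N y ^ p := by simp [dispNorm]

theorem meanDispersionEq_dispNorm_nonempty {N : Seminorm ℝ (Fin d → ℝ)} {p : ℝ} (hp : 1 ≤ p)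
    {e : Fin d → ℝ} (he : 0 < N e) (μ : Fin d → ℝ) {τ : ℝ} (hτ : 0 ≤ τ) :
    (meanDispersionEq μ (dispNorm N p μ) τ).Nonempty := by
  have hN : N ((τ ^ (1 / p) / N e) • e) ^ p = τ := by
    rw [map_smul_eq_mul, Real.norm_of_nonneg (by positivity), div_mul_cancel₀ _ he.ne',
      ← Real.rpow_mul hτ, one_div_mul_cancel (by linarith), Real.rpow_one]
  refine meanDispersionEq_nonempty_of_atoms (ι := Fin 2) (w := fun _ => 1 / 2)
    (y := ![(τ ^ (1 / p) / N e) • e, -((τ ^ (1 / p) / N e) • e)]) (dispNorm_self N hp μ)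
    (fun _ => by norm_num) (by simp) (by simp [Fin.sum_univ_two]) ?_
  simp only [Fin.sum_univ_two, Matrix.cons_val_zero, Matrix.cons_val_one, dispNorm_add,
    map_neg_eq_map, hN, smul_eq_mul]
  ring

theorem exists_atom_normMoment {N : Seminorm ℝ (Fin d → ℝ)} {p : ℝ} (hp : 1 ≤ p)
    {σ : ℝ} (hσ : 0 < σ) (μ : Fin d → ℝ) :
    ∃ κ : ℝ, 0 < κ ∧ ∀ (y : Fin d → ℝ) (q : ℝ), 0 ≤ q → q ≤ 1 / 4 → q * ‖y‖ ^ p ≤ κ →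
      (∃ Q ∈ (Dispersion.normMoment N p σ).ambiguityLe μ, ENNReal.ofReal q ≤ Q {μ + y}) ∧
      (((Dispersion.normMoment N p σ).ambiguityEq μ).Nonempty →
        ∃ Q ∈ (Dispersion.normMoment N p σ).ambiguityEq μ, ENNReal.ofReal q ≤ Q {μ + y}) := by
  obtain ⟨C, hC, hNC⟩ := exists_seminorm_le_mul_norm N
  refine ⟨σ / (2 * C ^ p), by positivity, fun y q hq hq4 hqy => ?_⟩
  have h1 : 0 ≤ σ - q • (dispNorm N p μ (μ + y) + dispNorm N p μ (μ + -y)) := by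
    rw [le_div_iff₀ (by positivity)] at hqy
    rw [dispNorm_add, dispNorm_add, map_neg_eq_map, smul_eq_mul]
    have h2 : N y ^ p ≤ C ^ p * ‖y‖ ^ p := by
      rw [← Real.mul_rpow hC.le (norm_nonneg y)]
      exact Real.rpow_le_rpow (apply_nonneg N y) (hNC y) (by linarith)
    have h3 : q * N y ^ p ≤ q * (C ^ p * ‖y‖ ^ p) := by gcongr
    nlinarith
  refine ⟨exists_atom_of_sub_mem (dispNorm_self N hp μ) hq hq4 y h1, fun hne =>
    exists_atom_of_nonempty hq hq4 y ?_⟩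
  by_cases hex : ∃ e : Fin d → ℝ, 0 < N e
  · obtain ⟨e, he⟩ := hex
    exact meanDispersionEq_dispNorm_nonempty hp he μ
      (mul_nonneg (inv_nonneg.2 (by linarith)) h1)
  · -- In dimension `0` no measure has the positive dispersion `σ`.
    push Not at hex
    obtain ⟨Q, hQ, -, -, -, hQσ⟩ := hne
    have : ∀ z, dispNorm N p μ z = 0 := fun z => by
      rw [dispNorm, le_antisymm (hex _) (apply_nonneg N _), Real.zero_rpow (by linarith)]
    simp [this] at hQσ
    exact absurd hQσ hσ.ne

/-! ### Atoms in the ambiguity sets -/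

/-- Every scenario `μ + y` carries mass of order `‖y‖ ^ (-p)`, or `1 / 4` if that is smaller, under
some measure of the ambiguity set. -/
theorem exists_atom_ambiguity {Δ : Dispersion d} (hΔ : Δ.Admissible) {μ : Fin d → ℝ}
    {P : Set (Measure (Fin d → ℝ))} (hP : P = Δ.ambiguityLe μ ∨ P = Δ.ambiguityEq μ)
    (hne : P.Nonempty) :
    ∃ κ : ℝ, 0 < κ ∧ ∀ (y : Fin d → ℝ) (q : ℝ), 0 ≤ q → q ≤ 1 / 4 → q * ‖y‖ ^ Δ.order ≤ κ →
      ∃ Q ∈ P, ENNReal.ofReal q ≤ Q {μ + y} := by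
  have key : ∃ κ : ℝ, 0 < κ ∧ ∀ (y : Fin d → ℝ) (q : ℝ), 0 ≤ q → q ≤ 1 / 4 →
      q * ‖y‖ ^ Δ.order ≤ κ →
      (∃ Q ∈ Δ.ambiguityLe μ, ENNReal.ofReal q ≤ Q {μ + y}) ∧
      ((Δ.ambiguityEq μ).Nonempty →
        ∃ Q ∈ Δ.ambiguityEq μ, ENNReal.ofReal q ≤ Q {μ + y}) := by
    cases Δ with
    | cov σ =>
      obtain ⟨κ, hκ, h⟩ := exists_atom_cov hΔ μ
      exact ⟨κ, hκ, fun y q h1 h2 h3 => ⟨(h y q h1 h2 h3).1, fun _ => (h y q h1 h2 h3).2⟩⟩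
    | absDev p σ =>
      obtain ⟨κ, hκ, h⟩ := exists_atom_absDev hΔ.1 hΔ.2 μ
      exact ⟨κ, hκ, fun y q h1 h2 h3 => ⟨(h y q h1 h2 h3).1, fun _ => (h y q h1 h2 h3).2⟩⟩
    | semiDev p σ => exact exists_atom_semiDev hΔ.1 hΔ.2 μ
    | normMoment N p σ => exact exists_atom_normMoment hΔ.1 hΔ.2.2 μ
  obtain ⟨κ, hκ, h⟩ := key
  refine ⟨κ, hκ, fun y q h1 h2 h3 => ?_⟩
  rcases hP with rfl | rfl
  · exact (h y q h1 h2 h3).1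
  · exact (h y q h1 h2 h3).2 hne

theorem Dispersion.Admissible.one_le_order {Δ : Dispersion d} (hΔ : Δ.Admissible) :
    1 ≤ Δ.order := by
  cases Δ with
  | cov σ => simp [Dispersion.order]
  | absDev p σ => exact hΔ.1
  | semiDev p σ => exact hΔ.1
  | normMoment N p σ => exact hΔ.1

end Models

/-! ### The cost on the decision set -/

section Geometry

variable {m : ℕ} {X : Set (Fin m → ℝ)} {c : (Fin m → ℝ) → ℝ} {r : ℝ}

theorem isCompact_annulus (hX : IsClosed (X ∪ {0})) {a : ℝ} (ha : 0 < a) (b : ℝ) :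
    IsCompact {x | x ∈ X ∧ a ≤ ‖x‖ ∧ ‖x‖ ≤ b} := by
  have h : {x | x ∈ X ∧ a ≤ ‖x‖ ∧ ‖x‖ ≤ b} =
      ((X ∪ {0}) ∩ {x | a ≤ ‖x‖}) ∩ Metric.closedBall 0 b := by
    ext x
    simp only [Set.mem_ofPred_eq, Set.mem_inter_iff, Set.mem_union, Set.mem_singleton_iff,
      mem_closedBall_zero_iff]
    constructor
    · rintro ⟨h1, h2, h3⟩; exact ⟨⟨Or.inl h1, h2⟩, h3⟩
    · rintro ⟨⟨h1 | h1, h2⟩, h3⟩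
      · exact ⟨h1, h2, h3⟩
      · subst h1; rw [norm_zero] at h2; linarith
  rw [h]
  exact (isCompact_closedBall 0 b).inter_left
    (hX.inter (isClosed_le continuous_const continuous_norm))

/-- Comparison with the compact section `‖y‖ = M ^ r` of `X`, which every nonzero decision reaches
by scaling, makes the cost comparable to the norm. -/
theorem exists_norm_bounds_cost (hr : r ≠ 0) (hX : IsClosed (X ∪ {0}))
    (hcone : ∃ M : ℝ, 0 < M ∧ ∀ x ∈ X, x ≠ 0 → ∀ s : ℝ, 0 < s →
      M ≤ ‖s • x‖ ^ (1 / r) → s • x ∈ X)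
    (hhom : ∀ x ∈ X, ∀ t : ℝ, 0 < t → t • x ∈ X → c (t • x) = t * c x)
    (hcont : ContinuousOn c X) (hsign : ∀ x ∈ X, x ≠ 0 → 0 < r * c x) :
    ∃ a b : ℝ, 0 < a ∧ 0 < b ∧ ∀ x ∈ X, x ≠ 0 → a * ‖x‖ ≤ r * c x ∧ r * c x ≤ b * ‖x‖ := by
  obtain ⟨M, hM, hcone⟩ := hcone
  set R : ℝ := M ^ r with hRdef
  have hR : 0 < R := Real.rpow_pos_of_pos hM r
  have hcomp := isCompact_annulus hX hR R
  set A := {x | x ∈ X ∧ R ≤ ‖x‖ ∧ ‖x‖ ≤ R} with hA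
  have hproj : ∀ x ∈ X, x ≠ 0 → ∃ y ∈ A, c x = ‖x‖ / R * c y := by
    intro x hx hx0
    have hn : 0 < ‖x‖ := norm_pos_iff.2 hx0
    have hnorm : ‖(R / ‖x‖) • x‖ = R := by
      rw [norm_smul, Real.norm_of_nonneg (by positivity)]; field_simp
    have hy : (R / ‖x‖) • x ∈ X := by
      refine hcone x hx hx0 _ (by positivity) ?_
      rw [hnorm, hRdef, ← Real.rpow_mul hM.le, mul_one_div_cancel hr, Real.rpow_one]
    refine ⟨_, ⟨hy, hnorm.ge, hnorm.le⟩, ?_⟩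
    rw [hhom x hx _ (by positivity) hy]
    field_simp
  have hcA : ContinuousOn (fun x => r * c x) A :=
    (continuousOn_const.mul hcont).mono fun x hx => hx.1
  have hne0 : ∀ y ∈ A, y ≠ 0 := by
    rintro y ⟨-, h, -⟩ rfl
    rw [norm_zero] at h; linarith
  rcases A.eq_empty_or_nonempty with hE | hne
  · refine ⟨1, 1, one_pos, one_pos, fun x hx hx0 => ?_⟩
    obtain ⟨y, hy, -⟩ := hproj x hx hx0
    simp [hE] at hy
  · obtain ⟨y1, hy1, hmin⟩ := hcomp.exists_isMinOn hne hcA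
    obtain ⟨y2, hy2, hmax⟩ := hcomp.exists_isMaxOn hne hcA
    have h1 := hsign y1 hy1.1 (hne0 y1 hy1)
    have h2 := hsign y2 hy2.1 (hne0 y2 hy2)
    refine ⟨r * c y1 / R, r * c y2 / R, by positivity, by positivity, fun x hx hx0 => ?_⟩
    obtain ⟨y, hy, hxy⟩ := hproj x hx hx0
    have e : r * c x = r * c y / R * ‖x‖ := by rw [hxy]; ring
    rw [e]
    have h3 : r * c y1 ≤ r * c y := hmin hy
    have h4 : r * c y ≤ r * c y2 := hmax hy
    constructor <;> gcongr

/-- A decision of large gauge `‖x‖ ^ (1 / r)` is expensive, in the sense fitting the sign of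
`r`. -/
theorem exists_cost_lower_bound (hr : r ≠ 0) {a b : ℝ} (ha : 0 < a) (hb : 0 < b)
    (hab : ∀ x ∈ X, x ≠ 0 → a * ‖x‖ ≤ r * c x ∧ r * c x ≤ b * ‖x‖) :
    ∃ v : ℝ, 0 < v ∧ ∀ x ∈ X, x ≠ 0 → ∀ τ : ℝ, 0 < τ → τ ≤ ‖x‖ ^ (1 / r) →
      Real.sign r * v * τ ^ r ≤ c x := by
  have hback : ∀ x : Fin m → ℝ, (‖x‖ ^ (1 / r)) ^ r = ‖x‖ := fun x => by
    rw [← Real.rpow_mul (norm_nonneg x), one_div_mul_cancel hr, Real.rpow_one]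
  rcases lt_or_gt_of_ne hr with hr | hr
  · refine ⟨b / -r, div_pos hb (by linarith), fun x hx hx0 τ hτ h => ?_⟩
    have h1 : ‖x‖ ≤ τ ^ r := by
      rw [← hback x]; exact Real.rpow_le_rpow_of_nonpos hτ h hr.le
    have h2 := (hab x hx hx0).2
    have h3 : r * c x ≤ b * τ ^ r := h2.trans (by gcongr)
    rw [Real.sign_of_neg hr, show -1 * (b / -r) * τ ^ r = (b * τ ^ r) / r by
      rw [div_neg]; ring, div_le_iff_of_neg hr]
    linarith
  · refine ⟨a / r, div_pos ha hr, fun x hx hx0 τ hτ h => ?_⟩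
    have h1 : τ ^ r ≤ ‖x‖ := by
      rw [← hback x]; exact Real.rpow_le_rpow hτ.le h hr.le
    have h2 := (hab x hx hx0).1
    have h3 : a * τ ^ r ≤ r * c x := le_trans (by gcongr) h2
    rw [Real.sign_of_pos hr, one_mul, div_mul_eq_mul_div, div_le_iff₀ hr]
    linarith

/-- Conversely, a lower bound on the cost keeps the gauge `‖x‖ ^ (1 / r)` away from `0`. -/
theorem exists_gauge_lower_bound (hr : r ≠ 0) {a b : ℝ} (ha : 0 < a) (hb : 0 < b)
    (hab : ∀ x ∈ X, x ≠ 0 → a * ‖x‖ ≤ r * c x ∧ r * c x ≤ b * ‖x‖) {c₀ : ℝ} (hc₀ : 0 < r * c₀) :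
    ∃ δ : ℝ, 0 < δ ∧ ∀ x ∈ X, x ≠ 0 → c₀ ≤ c x → δ ≤ ‖x‖ ^ (1 / r) := by
  rcases lt_or_gt_of_ne hr with hr | hr
  · refine ⟨(r * c₀ / a) ^ (1 / r), by positivity, fun x hx hx0 h => ?_⟩
    refine Real.rpow_le_rpow_of_nonpos (norm_pos_iff.2 hx0) ?_ (one_div_nonpos.2 hr.le)
    rw [le_div_iff₀ ha]
    nlinarith [(hab x hx hx0).1]
  · refine ⟨(r * c₀ / b) ^ (1 / r), by positivity, fun x hx hx0 h => ?_⟩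
    refine Real.rpow_le_rpow (by positivity) ?_ (by positivity)
    rw [div_le_iff₀ hb]
    nlinarith [(hab x hx hx0).2]

end Geometry

/-! ### Unsafe scenarios close to the origin -/

section Unsafe

variable {m d K : ℕ} {g : Fin K → (Fin m → ℝ) → (Fin d → ℝ) → EReal} {E : Set (Fin d → ℝ)}
  {X : Set (Fin m → ℝ)} {r : ℝ}

theorem eventually_notMem_safeSet
    (hg : ∀ k, LowerSemicontinuous (fun y : (Fin m → ℝ) × (Fin d → ℝ) => g k y.1 y.2))
    {x : Fin m → ℝ} {z : Fin d → ℝ} (hz : z ∈ E \ safeSet g E x) :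
    ∀ᶠ x' in 𝓝 x, z ∈ E \ safeSet g E x' := by
  have h : ¬ (⨆ k, g k x z) ≤ 0 := fun h => hz.2 ⟨hz.1, h⟩
  rw [iSup_le_iff] at h
  push Not at h
  obtain ⟨k, hk⟩ := h
  have hc : Tendsto (fun x' : Fin m → ℝ => (x', z)) (𝓝 x) (𝓝 (x, z)) := by
    exact (Continuous.prodMk_left z).tendsto x
  filter_upwards [hc.eventually (hg k (x, z) 0 hk)] with x' hx'
  exact ⟨hz.1, fun h => absurd ((le_iSup (fun k => g k x' z) k).trans h.2) (not_le.2 hx')⟩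

/-- Under the asymptotic model, a scenario `z` with `gs y z > 0` stays unsafe after scaling by
large `n`, uniformly near `y`. -/
theorem eventually_notMem_safeSet_of_asymptotic {ρ : ℝ}
    {gs : (Fin m → ℝ) → (Fin d → ℝ) → EReal}
    (hlim : ∀ (x : Fin m → ℝ) (z : Fin d → ℝ) (u : ℕ → Fin m → ℝ) (w : ℕ → Fin d → ℝ),
      Tendsto u atTop (𝓝 x) → Tendsto w atTop (𝓝 z) →
      gs x z ≤ liminf (fun n : ℕ =>
        (⨆ k, g k ((n : ℝ) ^ r • u n) ((n : ℝ) • w n)) / (((n : ℝ) ^ ρ : ℝ) : EReal)) atTop)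
    {y : Fin m → ℝ} {z : Fin d → ℝ} (hz : 0 < gs y z) :
    ∀ᶠ nu : ℕ × (Fin m → ℝ) in atTop ×ˢ 𝓝 y,
      (nu.1 : ℝ) • z ∉ safeSet g E ((nu.1 : ℝ) ^ r • nu.2) := by
  by_contra hcon
  obtain ⟨s, hs, hsafe⟩ := exists_seq_forall_of_frequently (not_eventually.1 hcon)
  -- Interpolate a subsequence with strictly increasing first components to a full sequence.
  obtain ⟨φ, hφ, hφs⟩ := strictMono_subseq_of_tendsto_atTop hs.fst
  set θ : ℕ → ℕ := fun n => (s (φ n)).1 with hθ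
  have hθm : StrictMono θ := hφs
  set u : ℕ → Fin m → ℝ := Function.extend θ (fun n => (s (φ n)).2) (fun _ => y) with hu
  have huθ : ∀ n, u (θ n) = (s (φ n)).2 := fun n => hθm.injective.extend_apply _ _ n
  have hsub : Tendsto (fun n => (s (φ n)).2) atTop (𝓝 y) := hs.snd.comp hφ.tendsto_atTop
  have hut : Tendsto u atTop (𝓝 y) := by
    intro V hV
    obtain ⟨N, hN⟩ := eventually_atTop.1 (hsub hV)
    refine mem_map.2 (mem_atTop_sets.2 ⟨θ N, fun n hn => ?_⟩)
    by_cases hex : ∃ k, θ k = n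
    · obtain ⟨k, rfl⟩ := hex
      rw [Set.mem_preimage, huθ]
      exact hN k (hθm.le_iff_le.1 hn)
    · rw [Set.mem_preimage, hu, Function.extend_apply' _ _ _ hex]
      exact mem_of_mem_nhds hV
  have hev := eventually_lt_of_lt_liminf (hz.trans_le (hlim y z u (fun _ => z) hut
    tendsto_const_nhds))
  obtain ⟨n, hn⟩ := (hθm.tendsto_atTop.eventually hev).exists
  refine not_le.2 hn (EReal.div_nonpos_of_nonpos_of_nonneg ?_ ?_)
  · rw [huθ]
    exact (not_not.1 (hsafe (φ n))).2
  · exact_mod_cast Real.rpow_nonneg (Nat.cast_nonneg _) ρ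

/-- In both models every decision `y` has a scenario `z` whose multiples `n • z` are unsafe for
all decisions `n ^ r • u` with `u` near `y` and `n` large. -/
theorem exists_eventually_unsafe (hE_cone : ∀ z ∈ E, ∀ t : ℝ, 0 < t → t • z ∈ E)
    (hg : ∀ k, LowerSemicontinuous (fun y : (Fin m → ℝ) × (Fin d → ℝ) => g k y.1 y.2))
    (hsafe : HomogeneousSafeSets g E X r ∨ AsymptoticSafeSets g E X r)
    (hviolable : ∀ x ∈ X, (E \ safeSet g E x).Nonempty) {y : Fin m → ℝ} (hy : y ∈ X) :
    ∃ z ∈ E, ∀ᶠ nu : ℕ × (Fin m → ℝ) in atTop ×ˢ 𝓝[X] y,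
      (nu.1 : ℝ) • z ∈ E \ safeSet g E ((nu.1 : ℝ) ^ r • nu.2) := by
  have hE : ∀ z ∈ E, ∀ᶠ nu : ℕ × (Fin m → ℝ) in atTop ×ˢ 𝓝[X] y, (nu.1 : ℝ) • z ∈ E := by
    intro z hz
    filter_upwards [tendsto_fst.eventually (eventually_gt_atTop 0)] with nu hnu
    exact hE_cone z hz _ (by exact_mod_cast hnu)
  rcases hsafe with ⟨hhom, -, -⟩ | ⟨-, ρ, gs, -, hlim, -, hnv, -⟩
  · obtain ⟨z, hz⟩ := hviolable y hy
    refine ⟨z, hz.1, ?_⟩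
    have h1 : ∀ᶠ u in 𝓝[X] y, z ∈ E \ safeSet g E u :=
      (eventually_notMem_safeSet hg hz).filter_mono nhdsWithin_le_nhds
    filter_upwards [hE z hz.1, tendsto_fst.eventually (eventually_gt_atTop 1),
      tendsto_snd.eventually h1, tendsto_snd.eventually (eventually_mem_nhdsWithin)]
      with nu h2 h3 h4 h5
    have h6 : (1 : ℝ) < nu.1 := by exact_mod_cast h3
    refine ⟨h2, fun h => h4.2 ?_⟩
    rw [(hhom _ h5 _ h6).2] at h
    exact (Set.smul_mem_smul_set_iff₀ (by linarith) _ _).1 h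
  · obtain ⟨z, hzE, hz⟩ := hnv y hy
    refine ⟨z, hzE, (hE z hzE).and (Eventually.mono ?_ fun nu h => h)⟩
    exact (eventually_notMem_safeSet_of_asymptotic hlim
      (not_le.1 fun h => hz ⟨hzE, h⟩)).filter_mono (prod_mono_right _ nhdsWithin_le_nhds)

/-- On a compact set of decisions, unsafe scenarios can be found in a fixed ball. -/
theorem exists_unsafe_bound_of_isCompact
    (hg : ∀ k, LowerSemicontinuous (fun y : (Fin m → ℝ) × (Fin d → ℝ) => g k y.1 y.2))
    (hviolable : ∀ x ∈ X, (E \ safeSet g E x).Nonempty) {A : Set (Fin m → ℝ)} (hA : IsCompact A)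
    (hAX : A ⊆ X) :
    ∃ H : ℝ, ∀ x ∈ A, ∃ z ∈ E \ safeSet g E x, ‖z‖ ≤ H := by
  refine hA.induction_on (p := fun s => ∃ H : ℝ, ∀ x ∈ s, ∃ z ∈ E \ safeSet g E x, ‖z‖ ≤ H)
    ⟨0, by simp⟩ ?_ ?_ ?_
  · rintro s t hst ⟨H, h⟩
    exact ⟨H, fun x hx => h x (hst hx)⟩
  · rintro s t ⟨H, h⟩ ⟨H', h'⟩
    refine ⟨max H H', ?_⟩
    rintro x (hx | hx)
    · obtain ⟨z, hz, hzH⟩ := h x hx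
      exact ⟨z, hz, hzH.trans (le_max_left _ _)⟩
    · obtain ⟨z, hz, hzH⟩ := h' x hx
      exact ⟨z, hz, hzH.trans (le_max_right _ _)⟩
  · intro x hx
    obtain ⟨z, hz⟩ := hviolable x (hAX hx)
    exact ⟨_, mem_nhdsWithin_of_mem_nhds (eventually_notMem_safeSet hg hz), ‖z‖,
      fun x' hx' => ⟨z, hx', le_rfl⟩⟩

/-- The uniform version for the decisions `n ^ r • u` with `u` in a compact set: the bound on the
unsafe scenarios grows linearly in `n`. -/
theorem exists_scaled_unsafe_bound_of_isCompact
    (hE_cone : ∀ z ∈ E, ∀ t : ℝ, 0 < t → t • z ∈ E)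
    (hg : ∀ k, LowerSemicontinuous (fun y : (Fin m → ℝ) × (Fin d → ℝ) => g k y.1 y.2))
    (hsafe : HomogeneousSafeSets g E X r ∨ AsymptoticSafeSets g E X r)
    (hviolable : ∀ x ∈ X, (E \ safeSet g E x).Nonempty) {A : Set (Fin m → ℝ)} (hA : IsCompact A)
    (hAX : A ⊆ X) :
    ∃ (H : ℝ) (N : ℕ), ∀ n ≥ N, ∀ u ∈ A, ∃ z ∈ E \ safeSet g E ((n : ℝ) ^ r • u),
      ‖z‖ ≤ n * H := by
  refine hA.induction_on (p := fun s => ∃ (H : ℝ) (N : ℕ), ∀ n ≥ N, ∀ u ∈ s,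
    ∃ z ∈ E \ safeSet g E ((n : ℝ) ^ r • u), ‖z‖ ≤ n * H) ⟨0, 0, by simp⟩ ?_ ?_ ?_
  · rintro s t hst ⟨H, N, h⟩
    exact ⟨H, N, fun n hn x hx => h n hn x (hst hx)⟩
  · rintro s t ⟨H, N, h⟩ ⟨H', N', h'⟩
    refine ⟨max H H', max N N', ?_⟩
    rintro n hn x (hx | hx)
    · obtain ⟨z, hz, hzH⟩ := h n ((le_max_left _ _).trans hn) x hx
      exact ⟨z, hz, hzH.trans (by gcongr; exact le_max_left _ _)⟩
    · obtain ⟨z, hz, hzH⟩ := h' n ((le_max_right _ _).trans hn) x hx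
      exact ⟨z, hz, hzH.trans (by gcongr; exact le_max_right _ _)⟩
  · intro y hy
    obtain ⟨z, -, h⟩ := exists_eventually_unsafe hE_cone hg hsafe hviolable (hAX hy)
    obtain ⟨p, hp, q, hq, hpq⟩ := eventually_prod_iff.1 h
    obtain ⟨N, hN⟩ := eventually_atTop.1 hp
    refine ⟨{u | q u}, nhdsWithin_mono y hAX hq, ‖z‖, N, fun n hn u hu =>
      ⟨(n : ℝ) • z, hpq (hN n hn) hu, ?_⟩⟩
    rw [norm_smul, Real.norm_natCast]

/-- A lower and an upper bound on `T ^ r` over `T ∈ [a, b]`, whatever the sign of `r`. -/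
theorem rpow_mem_Icc_min_max {a b T : ℝ} (ha : 0 < a) (h1 : a ≤ T) (h2 : T ≤ b) (r : ℝ) :
    min (a ^ r) (b ^ r) ≤ T ^ r ∧ T ^ r ≤ max (a ^ r) (b ^ r) := by
  have hT : 0 < T := ha.trans_le h1
  rcases le_total 0 r with hr | hr
  · exact ⟨(min_le_left _ _).trans (Real.rpow_le_rpow ha.le h1 hr),
      (Real.rpow_le_rpow hT.le h2 hr).trans (le_max_right _ _)⟩
  · exact ⟨(min_le_right _ _).trans (Real.rpow_le_rpow_of_nonpos hT h2 hr),
      (Real.rpow_le_rpow_of_nonpos ha h1 hr).trans (le_max_left _ _)⟩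

/-- Away from zero gauge, each decision has an unsafe scenario of norm at most a multiple of its
gauge `‖x‖ ^ (1 / r)`: decisions of large gauge are scaled back by the power of an integer to
gauges in `[M, 2 * M]`, the others form a compact set. -/
theorem exists_unsafe_le_gauge (hr : r ≠ 0)
    (hE_cone : ∀ z ∈ E, ∀ t : ℝ, 0 < t → t • z ∈ E)
    (hg : ∀ k, LowerSemicontinuous (fun y : (Fin m → ℝ) × (Fin d → ℝ) => g k y.1 y.2))
    (hsafe : HomogeneousSafeSets g E X r ∨ AsymptoticSafeSets g E X r)
    (hX : IsClosed (X ∪ {0}))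
    (hcone : ∃ M : ℝ, 0 < M ∧ ∀ x ∈ X, x ≠ 0 → ∀ s : ℝ, 0 < s →
      M ≤ ‖s • x‖ ^ (1 / r) → s • x ∈ X)
    (hviolable : ∀ x ∈ X, (E \ safeSet g E x).Nonempty) {δ : ℝ} (hδ : 0 < δ) :
    ∃ H : ℝ, 0 < H ∧ ∀ x ∈ X, x ≠ 0 → δ ≤ ‖x‖ ^ (1 / r) →
      ∃ z ∈ E \ safeSet g E x, ‖z‖ ≤ H * ‖x‖ ^ (1 / r) := by
  obtain ⟨M, hM, hcone⟩ := hcone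
  have hback : ∀ x : Fin m → ℝ, (‖x‖ ^ (1 / r)) ^ r = ‖x‖ := fun x => by
    rw [← Real.rpow_mul (norm_nonneg x), one_div_mul_cancel hr, Real.rpow_one]
  have hcomp : ∀ a b : ℝ, 0 < a → 0 < b →
      IsCompact {x | x ∈ X ∧ min (a ^ r) (b ^ r) ≤ ‖x‖ ∧ ‖x‖ ≤ max (a ^ r) (b ^ r)} :=
    fun a b ha hb => isCompact_annulus hX
      (lt_min (Real.rpow_pos_of_pos ha r) (Real.rpow_pos_of_pos hb r)) _
  obtain ⟨H₁, N, h₁⟩ := exists_scaled_unsafe_bound_of_isCompact hE_cone hg hsafe hviolable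
    (hcomp M (2 * M) hM (by positivity)) (fun x hx => hx.1)
  obtain ⟨H₂, h₂⟩ := exists_unsafe_bound_of_isCompact hg hviolable
    (hcomp δ (M * (N + 1)) hδ (by positivity)) (fun x hx => hx.1)
  refine ⟨max 1 (max (H₁ / M) (H₂ / δ)), by positivity, fun x hx hx0 hxδ => ?_⟩
  set T : ℝ := ‖x‖ ^ (1 / r) with hT
  have hTpos : 0 < T := hδ.trans_le hxδ
  have hTr : T ^ r = ‖x‖ := hback x
  rcases le_total T (M * (N + 1)) with hle | hge
  · obtain ⟨z, hz, hzH⟩ := h₂ x ⟨hx, by rw [← hTr]; exact rpow_mem_Icc_min_max hδ hxδ hle r⟩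
    refine ⟨z, hz, hzH.trans ?_⟩
    have hm : H₂ / δ ≤ max 1 (max (H₁ / M) (H₂ / δ)) :=
      (le_max_right _ _).trans (le_max_right _ _)
    rw [div_le_iff₀ hδ] at hm
    exact hm.trans (by gcongr)
  · set n : ℕ := ⌊T / M⌋₊ with hn
    have hTM : (N : ℝ) + 1 ≤ T / M := by rw [le_div_iff₀ hM]; linarith
    have hNn : N + 1 ≤ n := Nat.le_floor (by exact_mod_cast hTM)
    have hn1 : (1 : ℝ) ≤ n := by exact_mod_cast (Nat.le_add_left 1 N).trans hNn
    have hn0 : (0 : ℝ) < n := by linarith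
    have hnT : n * M ≤ T := by
      have := Nat.floor_le (div_nonneg hTpos.le hM.le)
      rwa [le_div_iff₀ hM] at this
    have hTn : T ≤ n * (2 * M) := by
      have h3 : T / M < n + 1 := Nat.lt_floor_add_one _
      rw [div_lt_iff₀ hM] at h3
      nlinarith
    have hnr : 0 < (n : ℝ) ^ r := Real.rpow_pos_of_pos hn0 r
    set y : Fin m → ℝ := ((n : ℝ) ^ r)⁻¹ • x with hy
    have hynorm : ‖y‖ = (T / n) ^ r := by
      rw [hy, norm_smul, norm_inv, Real.norm_of_nonneg hnr.le, Real.div_rpow hTpos.le hn0.le,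
        hTr]
      ring
    have hyT : ‖y‖ ^ (1 / r) = T / n := by
      rw [hynorm, ← Real.rpow_mul (by positivity), mul_one_div_cancel hr, Real.rpow_one]
    have hMy : M ≤ T / n := by rw [le_div_iff₀ hn0]; linarith
    have hyM : T / n ≤ 2 * M := by rw [div_le_iff₀ hn0]; linarith
    have hyX : y ∈ X := hcone x hx hx0 _ (inv_pos.2 hnr) (by rw [← hy, hyT]; exact hMy)
    obtain ⟨z, hz, hzH⟩ := h₁ n ((Nat.le_succ N).trans hNn) y
      ⟨hyX, by rw [hynorm]; exact rpow_mem_Icc_min_max hM hMy hyM r⟩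
    rw [hy, smul_inv_smul₀ hnr.ne'] at hz
    refine ⟨z, hz, hzH.trans ?_⟩
    have hm : H₁ / M ≤ max 1 (max (H₁ / M) (H₂ / δ)) :=
      (le_max_left _ _).trans (le_max_right _ _)
    rw [div_le_iff₀ hM] at hm
    calc n * H₁ ≤ n * (max 1 (max (H₁ / M) (H₂ / δ)) * M) := by gcongr
      _ = max 1 (max (H₁ / M) (H₂ / δ)) * (n * M) := by ring
      _ ≤ _ := by gcongr

end Unsafe

/-! ### Feasible and optimal decisions -/

section Feasible

variable {m d K : ℕ} {g : Fin K → (Fin m → ℝ) → (Fin d → ℝ) → EReal} {E : Set (Fin d → ℝ)}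
  {X : Set (Fin m → ℝ)}

/-- An unsafe atom of some measure in the ambiguity set has at most mass `α`. -/
theorem le_of_mem_droFeasible {P : Set (Measure (Fin d → ℝ))}
    (hprob : ∀ Q ∈ P, IsProbabilityMeasure Q) {α q : ℝ} (hα : α ≤ 1) (hq : 0 ≤ q)
    {x : Fin m → ℝ} (hx : x ∈ droFeasible g X P α)
    {z : Fin d → ℝ} (hz : z ∈ E \ safeSet g E x)
    (hQ : ∃ Q ∈ P, ENNReal.ofReal q ≤ Q {z}) : q ≤ α := by
  obtain ⟨Q, hQP, hQz⟩ := hQ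
  have := hprob Q hQP
  have h1 : ENNReal.ofReal (1 - α) ≤ Q {z}ᶜ := by
    refine (hx.2.trans (iInf₂_le Q hQP)).trans (measure_mono fun w hw => ?_)
    rintro rfl
    exact hz.2 ⟨hz.1, iSup_le hw⟩
  have h2 : ENNReal.ofReal (1 - α + q) ≤ 1 := by
    rw [ENNReal.ofReal_add (by linarith) hq]
    calc _ ≤ Q {z}ᶜ + Q {z} := add_le_add h1 hQz
      _ = 1 := by rw [add_comm, measure_add_measure_compl (measurableSet_singleton z), measure_univ]
  rw [ENNReal.ofReal_le_one] at h2
  linarith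

/-- A feasible decision at a small level `α` is safe at all scenarios whose norm is small compared
to `α ^ (-1 / p)`: otherwise some measure of the ambiguity set has too large an atom there. -/
theorem exists_unsafe_norm_lower_bound {Δ : Dispersion d} (hΔ : Δ.Admissible) {μ : Fin d → ℝ}
    {P : Set (Measure (Fin d → ℝ))} (hP : P = Δ.ambiguityLe μ ∨ P = Δ.ambiguityEq μ)
    (hne : P.Nonempty) :
    ∃ κ : ℝ, 0 < κ ∧ ∀ α : ℝ, 0 < α → α < 1 / 4 → ∀ x ∈ droFeasible g X P α,
      ∀ z ∈ E \ safeSet g E x, κ * α ^ (-(1 / Δ.order)) ≤ 1 + ‖μ‖ + ‖z‖ := by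
  have hprob : ∀ Q ∈ P, IsProbabilityMeasure Q := by
    rcases hP with rfl | rfl <;> cases Δ <;> exact fun Q hQ => hQ.1
  obtain ⟨κ, hκ, h⟩ := exists_atom_ambiguity hΔ hP hne
  have hp := hΔ.one_le_order
  set p := Δ.order with hpdef
  refine ⟨κ ^ (1 / p), by positivity, fun α hα hα4 x hx z hz => ?_⟩
  set B : ℝ := 1 + ‖μ‖ + ‖z‖ with hB
  have hBpos : 0 < B := by positivity
  have hBp : 0 < B ^ p := by positivity
  have hyB : ‖z - μ‖ ≤ B := by
    have := norm_sub_le z μ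
    linarith
  have hq0 : 0 ≤ min (1 / 4) (κ / B ^ p) := by positivity
  have hqα : min (1 / 4) (κ / B ^ p) ≤ α := by
    refine le_of_mem_droFeasible hprob (by linarith) hq0 hx hz ?_
    have := h (z - μ) _ hq0 (min_le_left _ _) ?_
    · simpa using this
    · calc min (1 / 4) (κ / B ^ p) * ‖z - μ‖ ^ p ≤ κ / B ^ p * B ^ p := by
            gcongr
            exact min_le_right _ _
        _ = κ := by field_simp
  have h1 : κ / B ^ p ≤ α := (min_le_iff.1 hqα).resolve_left (by linarith)
  have h2 : κ * α⁻¹ ≤ B ^ p := by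
    rw [div_le_iff₀ hBp] at h1
    rw [← div_eq_mul_inv, div_le_iff₀ hα]
    linarith
  calc κ ^ (1 / p) * α ^ (-(1 / p)) = (κ * α⁻¹) ^ (1 / p) := by
        rw [Real.mul_rpow hκ.le (by positivity), Real.inv_rpow hα.le, Real.rpow_neg hα.le]
    _ ≤ (B ^ p) ^ (1 / p) := Real.rpow_le_rpow (by positivity) h2 (by positivity)
    _ = B := by rw [← Real.rpow_mul hBpos.le, mul_one_div_cancel (by linarith), Real.rpow_one]

theorem droFeasible_mono (P : Set (Measure (Fin d → ℝ))) {α α' : ℝ} (h : α ≤ α') :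
    droFeasible g X P α ⊆ droFeasible g X P α' := fun _ hx =>
  ⟨hx.1, (ENNReal.ofReal_le_ofReal (by linarith)).trans hx.2⟩

end Feasible

end MomentDRO

theorem mainTheorem7 {m d K : ℕ}
    (E : Set (Fin d → ℝ)) (hE_closed : IsClosed E)
    (hE_cone : ∀ z ∈ E, ∀ t : ℝ, 0 < t → t • z ∈ E)
    (g : Fin K → (Fin m → ℝ) → (Fin d → ℝ) → EReal)
    (hg : ∀ k, LowerSemicontinuous (fun y : (Fin m → ℝ) × (Fin d → ℝ) => g k y.1 y.2))
    (X : Set (Fin m → ℝ)) (c : (Fin m → ℝ) → ℝ)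
    (r : ℝ) (hr : r ≠ 0)
    -- the constraint functions and the cost function
    (hsafe : MomentDRO.HomogeneousSafeSets g E X r ∨ MomentDRO.AsymptoticSafeSets g E X r)
    (hcost : MomentDRO.HomogeneousCost c X (MomentDRO.decisionsWithInterior g E X) r)
    -- regularity of the instance
    (hX_closed : IsClosed (X ∪ {0}))
    (hX_cone : ∃ M : ℝ, 0 < M ∧ ∀ x ∈ X, x ≠ 0 → ∀ s : ℝ, 0 < s →
      M ≤ ‖s • x‖ ^ (1 / r) → s • x ∈ X)
    (hc_cont : ContinuousOn c X)
    (hc_sign : ∀ x ∈ X, x ≠ 0 → 0 < r * c x)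
    (hviolable : ∀ x ∈ X, (E \ MomentDRO.safeSet g E x).Nonempty)
    -- the ambiguity set
    (μ : Fin d → ℝ) (Δ : MomentDRO.Dispersion d) (hΔ : Δ.Admissible)
    (P : Set (MeasureTheory.Measure (Fin d → ℝ)))
    (hP : P = Δ.ambiguityLe μ ∨ P = Δ.ambiguityEq μ) (hP_nonempty : P.Nonempty)
    (ε : ℝ) (hε : 0 < ε) :
    ∃ v : ℝ, 0 < v ∧ ∃ α₀ : ℝ, 0 < α₀ ∧ ∀ α : ℝ, 0 < α → α < α₀ →
      ∀ x : Fin m → ℝ, MomentDRO.IsDROOptimal c g X P α x →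
        Real.sign r * v * α ^ (-(r / (Δ.order + ε))) ≤ c x := by
  open MomentDRO in
  obtain ⟨κ, hκ, hfeas⟩ := exists_unsafe_norm_lower_bound (g := g) (E := E) (X := X) hΔ hP
    hP_nonempty
  have hp := hΔ.one_le_order
  set p := Δ.order with hpdef
  obtain ⟨a, b, ha, hb, hab⟩ :=
    exists_norm_bounds_cost hr hX_closed hX_cone hcost.1 hc_cont hc_sign
  -- The zero decision is infeasible at small levels.
  obtain ⟨α₂, hα₂, hα₂4, hzero⟩ : ∃ α₂ : ℝ, 0 < α₂ ∧ α₂ ≤ 1 / 4 ∧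
      ∀ α, 0 < α → α < α₂ → (0 : Fin m → ℝ) ∉ droFeasible g X P α := by
    by_cases h0 : (0 : Fin m → ℝ) ∈ X
    · obtain ⟨z, hz⟩ := hviolable 0 h0
      have hev : ∀ᶠ α in 𝓝[>] (0 : ℝ), 1 + ‖μ‖ + ‖z‖ < κ * α ^ (-(1 / p)) :=
        ((tendsto_rpow_neg_nhdsGT_zero (neg_neg_of_pos (by positivity : 0 < 1 / p))).const_mul_atTop
          hκ).eventually_gt_atTop _
      obtain ⟨η, hη, h⟩ := mem_nhdsGT_iff_exists_Ioo_subset.1 hev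
      refine ⟨min η (1 / 4), lt_min hη (by norm_num), min_le_right _ _, fun α h1 h2 h3 => ?_⟩
      have h4 := hfeas α h1 (h2.trans_le (min_le_right _ _)) 0 h3 z hz
      exact absurd h4 (not_le.2 (h ⟨h1, h2.trans_le (min_le_left _ _)⟩))
    · exact ⟨1 / 4, by norm_num, le_rfl, fun α _ _ h => h0 h.1⟩
  by_cases hex : ∃ α₁ x₁, 0 < α₁ ∧ α₁ < α₂ ∧ IsDROOptimal c g X P α₁ x₁
  swap
  · refine ⟨1, one_pos, α₂, hα₂, fun α h1 h2 x hx => absurd ⟨α, x, h1, h2, hx⟩ hex⟩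
  -- The optimal cost at one level `α₁` bounds the optimal costs at all smaller levels from below,
  -- which keeps those optimal decisions away from zero gauge.
  obtain ⟨α₁, x₁, hα₁, hα₁₂, hx₁⟩ := hex
  have hx₁0 : x₁ ≠ 0 := by
    rintro rfl
    exact hzero α₁ hα₁ hα₁₂ hx₁.1
  obtain ⟨δ, hδ, hgauge⟩ := exists_gauge_lower_bound hr ha hb hab (hc_sign x₁ hx₁.1.1 hx₁0)
  obtain ⟨H, hH, hnear⟩ :=
    exists_unsafe_le_gauge hr hE_cone hg hsafe hX_closed hX_cone hviolable hδ
  obtain ⟨v, hv, hlow⟩ := exists_cost_lower_bound (c := c) (X := X) hr ha hb hab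
  set H' : ℝ := H + (1 + ‖μ‖) / δ with hH'
  have hH'pos : 0 < H' := by positivity
  refine ⟨v * (κ / H') ^ r, by positivity, α₁, hα₁, fun α hα hαα₁ x hx => ?_⟩
  have hα1 : α < 1 := by linarith
  have hx0 : x ≠ 0 := by
    rintro rfl
    exact hzero α hα (hαα₁.trans hα₁₂) hx.1
  have hδx : δ ≤ ‖x‖ ^ (1 / r) :=
    hgauge x hx.1.1 hx0 (hx₁.2 x (droFeasible_mono P hαα₁.le hx.1))
  obtain ⟨z, hz, hzH⟩ := hnear x hx.1.1 hx0 hδx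
  have h1 := hfeas α hα (by linarith) x hx.1 z hz
  have h2 : κ / H' * α ^ (-(1 / p)) ≤ ‖x‖ ^ (1 / r) := by
    have h3 : 1 + ‖μ‖ ≤ (1 + ‖μ‖) / δ * ‖x‖ ^ (1 / r) := by
      rw [div_mul_eq_mul_div, le_div_iff₀ hδ]
      gcongr
    rw [div_mul_eq_mul_div, div_le_iff₀ hH'pos, hH']
    linarith
  have h4 := hlow x hx.1.1 hx0 _ (by positivity) h2
  rw [Real.mul_rpow (by positivity) (by positivity), ← Real.rpow_mul hα.le] at h4
  refine le_trans ?_ h4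
  have e : -(1 / p) * r = -(r / p) := by ring
  rw [e, ← mul_assoc, ← mul_assoc]
  -- The exponent `p` gives a stronger bound than `p + ε`, in the sense fitting the sign of `r`.
  have hvpos : 0 ≤ v * (κ / H') ^ r := by positivity
  rcases lt_or_gt_of_ne hr with hneg | hpos
  · have h5 : α ^ (-(r / p)) ≤ α ^ (-(r / (p + ε))) :=
      Real.rpow_le_rpow_of_exponent_ge hα hα1.le (neg_le_neg
        (by rw [div_le_div_iff₀ (by linarith) (by linarith)]; nlinarith))
    rw [Real.sign_of_neg hneg]
    nlinarith [mul_le_mul_of_nonneg_left h5 hvpos]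
  · have h5 : α ^ (-(r / (p + ε))) ≤ α ^ (-(r / p)) :=
      Real.rpow_le_rpow_of_exponent_ge hα hα1.le (neg_le_neg
        (div_le_div_of_nonneg_left hpos.le (by linarith) (by linarith)))
    rw [Real.sign_of_pos hpos]
    nlinarith [mul_le_mul_of_nonneg_left h5 hvpos]
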